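/- Let $G$ be a connected (simple, possibly infinite) graph. A *ray* of $G$ is a one-way infinite path $v_0v_1v_2\dots$ with pairwise distinct vertices. Two rays are *edge-equivalent* if, for every finite set $F'\subseteq E(G)$, they have tails in the same connected component of $G\setminus F'$; the equivalence classes are the *edge-ends* of $G$, and $\Omega_E(G)$ is the set of all edge-ends. A vertex $v$ *edge-dominates* an edge-end $\omega$ if, for every finite $F'\subseteq E(G)$, the component of $G\setminus F'$ containing $v$ contains a tail of every ray representing $\omega$. For $S\subseteq V(G)$ and $A\subseteq\Omega_E(G)$, an *$S$–$A$ path* is either a ray that starts at a vertex of $S$ and whose edge-end belongs to $A$, or a finite path (possibly a single vertex) from a vertex of $S$ to a vertex that edge-dominates some edge-end in $A$. A set $F\subseteq E(G)$ *separates* $S$ from $A$ if there is no $S$–$A$ path in $G\setminus F$, that is, if every $S$–$A$ path of $G$ uses an edge of $F$. **Lemma.** Let $S\subseteq V(G)$ and $A\subseteq\Omega_E(G)$. Suppose that some finite set of edges of $G$ separates $S$ from $A$, and let $F\subseteq E(G)$ be such a finite set of minimum cardinality. Then there is a family of $|F|$ pairwise edge-disjoint (and distinct) $S$–$A$ paths.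 -/

import Mathlib

namespace EdgeMenger

variable {V : Type*}

/-- A ray of `G`: a one-way infinite path `v₀ v₁ v₂ …` with pairwise distinct vertices. -/
structure Ray (G : SimpleGraph V) where
  /-- the `i`-th vertex of the ray -/
  vert : ℕ → V
  inj : Function.Injective vert
  adj : ∀ i, G.Adj (vert i) (vert (i + 1))

/-- The edge set of a ray. -/
def Ray.edges {G : SimpleGraph V} (r : Ray G) : Set (Sym2 V) :=
  Set.range fun i => s(r.vert i, r.vert (i + 1))

/-- The ray `r` has a tail in the connected component `C` of `G \ F`. -/
def Ray.HasTailIn {G : SimpleGraph V} (r : Ray G) {F : Set (Sym2 V)}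
    (C : (G.deleteEdges F).ConnectedComponent) : Prop :=
  ∃ n, ∀ i, n ≤ i → r.vert i ∈ C.supp

theorem Ray.edge_injective {G : SimpleGraph V} (r : Ray G) :
    Function.Injective fun i => s(r.vert i, r.vert (i + 1)) := by
  intro i j h
  simp only [Sym2.eq_iff] at h
  rcases h with ⟨h, -⟩ | ⟨h, h'⟩
  · exact r.inj h
  · have := r.inj h
    have := r.inj h'
    omega

/-- Every ray has a tail in some component of `G \ F`, for every finite `F`. -/
theorem Ray.exists_hasTailIn {G : SimpleGraph V} (r : Ray G) {F : Set (Sym2 V)}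
    (hF : F.Finite) : ∃ C : (G.deleteEdges F).ConnectedComponent, r.HasTailIn C := by
  have hfin : {i | s(r.vert i, r.vert (i + 1)) ∈ F}.Finite :=
    hF.preimage r.edge_injective.injOn
  obtain ⟨N, hN⟩ := hfin.bddAbove
  refine ⟨(G.deleteEdges F).connectedComponentMk (r.vert (N + 1)), N + 1, fun i hi => ?_⟩
  rw [SimpleGraph.ConnectedComponent.mem_supp_iff, SimpleGraph.ConnectedComponent.eq]
  induction i, hi using Nat.le_induction with
  | base => exact SimpleGraph.Reachable.refl _
  | succ i hi ih =>
    refine SimpleGraph.Reachable.trans ?_ ih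
    refine (SimpleGraph.Adj.reachable ?_).symm
    rw [SimpleGraph.deleteEdges_adj]
    refine ⟨r.adj i, fun h => ?_⟩
    have : i ≤ N := hN h
    omega

theorem Ray.hasTailIn_unique {G : SimpleGraph V} (r : Ray G) {F : Set (Sym2 V)}
    {C D : (G.deleteEdges F).ConnectedComponent} (hC : r.HasTailIn C) (hD : r.HasTailIn D) :
    C = D := by
  obtain ⟨m, hm⟩ := hC
  obtain ⟨n, hn⟩ := hD
  have h1 := hm (max m n) (le_max_left _ _)
  have h2 := hn (max m n) (le_max_right _ _)
  rw [SimpleGraph.ConnectedComponent.mem_supp_iff] at h1 h2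
  exact h1.symm.trans h2

/-- Rays `r`, `s` are edge-equivalent if, for every finite set `F` of edges of `G`, they have
tails in the same connected component of `G \ F`. -/
def EdgeEquiv (G : SimpleGraph V) (r s : Ray G) : Prop :=
  ∀ F : Set (Sym2 V), F.Finite → F ⊆ G.edgeSet →
    ∃ C : (G.deleteEdges F).ConnectedComponent, r.HasTailIn C ∧ s.HasTailIn C

/-- Edge-equivalence as an equivalence relation on the rays of `G`. -/
def edgeSetoid (G : SimpleGraph V) : Setoid (Ray G) where
  r := EdgeEquiv G
  iseqv :=
    { refl := fun r F hF _ => by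
        obtain ⟨C, hC⟩ := r.exists_hasTailIn hF
        exact ⟨C, hC, hC⟩
      symm := fun h F hF hFG => by
        obtain ⟨C, h1, h2⟩ := h F hF hFG
        exact ⟨C, h2, h1⟩
      trans := fun {r s t} hrs hst F hF hFG => by
        obtain ⟨C, h1, h2⟩ := hrs F hF hFG
        obtain ⟨D, h3, h4⟩ := hst F hF hFG
        have := s.hasTailIn_unique h2 h3
        subst this
        exact ⟨C, h1, h4⟩ }

/-- The edge-end space of `G` (as a set): rays modulo edge-equivalence. -/
def EdgeEnd (G : SimpleGraph V) : Type _ := Quotient (edgeSetoid G)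

/-- The edge-end of a ray. -/
def Ray.edgeEnd {G : SimpleGraph V} (r : Ray G) : EdgeEnd G := Quotient.mk (edgeSetoid G) r

/-- The vertex `v` edge-dominates the edge-end `ω`: for every finite set `F` of edges of `G`, the
component of `G \ F` containing `v` contains a tail of every ray representing `ω`. -/
def EdgeDominates (G : SimpleGraph V) (v : V) (ω : EdgeEnd G) : Prop :=
  ∀ r : Ray G, r.edgeEnd = ω → ∀ F : Set (Sym2 V), F.Finite → F ⊆ G.edgeSet →
    r.HasTailIn ((G.deleteEdges F).connectedComponentMk v)

/-- An `S`–`A` path in `G`, for a set `S` of vertices and a set `A` of edge-ends: either a ray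
starting in `S` whose edge-end lies in `A`, or a finite path (possibly of length zero) from a vertex
of `S` to a vertex that edge-dominates some edge-end in `A`. -/
inductive VertexEndPath (G : SimpleGraph V) (S : Set V) (A : Set (EdgeEnd G)) : Type _
  | ray (r : Ray G) (start_mem : r.vert 0 ∈ S) (end_mem : r.edgeEnd ∈ A)
  | finite {u v : V} (p : G.Walk u v) (isPath : p.IsPath) (start_mem : u ∈ S)
      (dominates : ∃ ω ∈ A, EdgeDominates G v ω)

/-- The edge set of an `S`–`A` path. -/
def VertexEndPath.edges {G : SimpleGraph V} {S : Set V} {A : Set (EdgeEnd G)} :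
    VertexEndPath G S A → Set (Sym2 V)
  | .ray r _ _ => r.edges
  | .finite p _ _ _ => {e | e ∈ p.edges}

/-- `F` separates `S` from `A`: there is no `S`–`A` path in `G \ F`, i.e. no `S`–`A` path of `G`
avoids all edges of `F`. (For finite `F`, edge-ends and edge-domination are the same in `G \ F` as
in `G`.) -/
def Separates (G : SimpleGraph V) (S : Set V) (A : Set (EdgeEnd G)) (F : Set (Sym2 V)) : Prop :=
  ∀ P : VertexEndPath G S A, ¬ Disjoint P.edges F

end EdgeMenger

namespace EdgeMenger

variable {V : Type*}

/-! Separators are handled through vertex sets. A finite separator `F` gives the set of vertices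
reachable from `S` without `F`; this set contains `S`, has its boundary inside `F`, and contains no
tail of a ray of `A`. Conversely, the boundary of any such set (`EndCut`) separates `S` from `A`.
Hence every `EndCut` has at least `k = |F|` boundary edges.

Finitely many ends already force this bound (`exists_finite_ends`). Choose a finite `B ⊆ A` whose
minimum cut is as large as possible. By submodularity the minimum cuts for `B` are closed under
intersection, and the intersection of all of them still has minimum boundary. It excludes every end
`ω` of `A`, because a minimum cut for `B ∪ {ω}` is, by maximality, also one for `B`. So the minimum
cut for `B` is at least `k`.

Finitely many ends can be placed in disjoint components by deleting finitely many edges. In each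
component a target set replaces the end (`exists_target`): a dominating vertex if there is one,
otherwise a neighbourhood whose boundary edges all extend to edge-disjoint rays of the end inside
it. Such rays are obtained by linking the boundaries of a shrinking sequence of neighbourhoods of
minimum boundary (`exists_linkage`, `exists_ray_system`). Edge-Menger between `S` and the union of
the targets gives `k` disjoint walks, which are stopped at their first target vertex and extended.

Edge-Menger for finite edge sets is vertex-Menger (Göring's induction) applied to incidence of
edges; an ultrafilter limit of small separators extends it to infinite graphs. -/

/-! ### Menger's theorem for relations with finitely many pairs -/

/-- Inside `U` there is an `r`-chain from an element of `A` to an element of `B`. -/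
def Conn {α : Type*} (r : α → α → Prop) (U A B : Set α) : Prop :=
  ∃ a ∈ A, ∃ b ∈ B, a ∈ U ∧ Relation.ReflTransGen (fun x y => r x y ∧ y ∈ U) a b

theorem reflTransGen_within_mono {α : Type*} {r r' : α → α → Prop} {U U' : Set α} {a b : α}
    (h : Relation.ReflTransGen (fun x y => r x y ∧ y ∈ U) a b)
    (hr : ∀ x y, r x y → r' x y) (hU : U ⊆ U') :
    Relation.ReflTransGen (fun x y => r' x y ∧ y ∈ U') a b :=
  Relation.ReflTransGen.mono (fun _ _ h => ⟨hr _ _ h.1, hU h.2⟩) _ _ h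

/-- The restricted relation constrains only the target of each step, so membership of the start in
`U` is a separate assumption; this is why `Conn` records `a ∈ U`. -/
theorem reflTransGen_within_swap {α : Type*} {r : α → α → Prop} {U : Set α} {a b : α}
    (ha : a ∈ U) (h : Relation.ReflTransGen (fun x y => r x y ∧ y ∈ U) a b) :
    b ∈ U ∧ Relation.ReflTransGen (fun x y => r y x ∧ y ∈ U) b a := by
  induction h with
  | refl => exact ⟨ha, .refl⟩
  | tail _ hbc ih => exact ⟨hbc.2, ih.2.head ⟨hbc.1, ih.1⟩⟩

theorem Conn.swap {α : Type*} {r : α → α → Prop} {U A B : Set α} (h : Conn r U A B) :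
    Conn (fun x y => r y x) U B A := by
  obtain ⟨a, ha, b, hb, haU, h⟩ := h
  obtain ⟨hbU, h'⟩ := reflTransGen_within_swap haU h
  exact ⟨b, hb, a, ha, hbU, h'⟩

theorem Conn.mono {α : Type*} {r r' : α → α → Prop} {U U' A B : Set α} (h : Conn r U A B)
    (hr : ∀ x y, r x y → r' x y) (hU : U ⊆ U') : Conn r' U' A B := by
  obtain ⟨a, ha, b, hb, haU, h⟩ := h
  exact ⟨a, ha, b, hb, hU haU, reflTransGen_within_mono h hr hU⟩

/-- A chain of `r` meeting the separator `insert x Z` of `r` minus the pair `(x, y)` has an initial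
piece that reaches `insert x Z` without using the pair `(x, y)`. -/
theorem Conn.to_separator {α : Type*} {r : α → α → Prop} {A B Z W : Set α} {x y : α}
    (hZ : ¬ Conn (fun u v => r u v ∧ ¬ (u = x ∧ v = y)) Zᶜ A B) (h : Conn r W A B) :
    Conn (fun u v => r u v ∧ ¬ (u = x ∧ v = y)) W A (insert x Z) := by
  obtain ⟨a, ha, b, hb, haU, h⟩ := h
  by_contra hcon
  -- If no such piece existed, the chain would never visit `x`, hence never use the pair `(x, y)`,
  -- and would avoid `Z` altogether, contradicting `hZ`.
  have key : ∀ v, Relation.ReflTransGen (fun x y => r x y ∧ y ∈ W) a v →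
      v ∉ insert x Z ∧
      Relation.ReflTransGen (fun u v => (r u v ∧ ¬ (u = x ∧ v = y)) ∧ v ∈ W) a v ∧
      a ∈ Zᶜ ∧ Relation.ReflTransGen (fun u v => (r u v ∧ ¬ (u = x ∧ v = y)) ∧ v ∈ Zᶜ) a v := by
    intro v hv
    induction hv with
    | refl =>
      have : a ∉ insert x Z := fun h' => hcon ⟨a, ha, a, h', haU, .refl⟩
      exact ⟨this, .refl, fun h' => this (Or.inr h'), .refl⟩
    | @tail v w _ hvw ih =>
      obtain ⟨h1, h2, h3, h4⟩ := ih
      have hne : ¬ (v = x ∧ w = y) := fun h' => h1 (Or.inl h'.1)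
      have h2' := h2.tail (b := v) (c := w) ⟨⟨hvw.1, hne⟩, hvw.2⟩
      have hw : w ∉ insert x Z := fun h' => hcon ⟨a, ha, w, h', haU, h2'⟩
      exact ⟨hw, h2', h3, h4.tail ⟨⟨hvw.1, hne⟩, fun h' => hw (Or.inr h')⟩⟩
  obtain ⟨-, -, h3, h4⟩ := key b h
  exact hZ ⟨a, ha, b, hb, h3, h4⟩

/-- Given as many disjoint chains from `A` to the finite set `C = insert x Z` as `C` has elements,
label them by their endpoints and trim them to vertices reachable from `A` outside `Z`. -/
theorem exists_trimmed {α : Type*} {r : α → α → Prop} {A Z : Set α} {x : α} {k : ℕ}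
    (hfin : (insert x Z).Finite) (hcard : (insert x Z).ncard = k) (hx : x ∉ Z)
    (U : Fin k → Set α) (hU : Pairwise fun i j => Disjoint (U i) (U j))
    (hc : ∀ i, Conn r (U i) A (insert x Z)) :
    ∃ V : α → Set α,
      (∀ c ∈ insert x Z, ∃ a ∈ A, a ∈ V c ∧
        Relation.ReflTransGen (fun u v => r u v ∧ v ∈ V c) a c) ∧
      (∀ c ∈ insert x Z, ∀ d ∈ insert x Z, c ≠ d → Disjoint (V c) (V d)) ∧
      (∀ c ∈ insert x Z, ∀ v ∈ V c, v = c ∨ Conn r Zᶜ A {v}) ∧ Conn r Zᶜ A {x} := by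
  choose a ha c hcC haU hrtg using hc
  have hcU : ∀ i, c i ∈ U i := fun i => (reflTransGen_within_swap (haU i) (hrtg i)).1
  have hinj : Function.Injective c := by
    intro i j hij
    by_contra hne
    exact Set.disjoint_left.1 (hU hne) (hcU i) (hij ▸ hcU j)
  have hrange : Set.range c = insert x Z := by
    refine Set.eq_of_subset_of_ncard_le (Set.range_subset_iff.2 hcC) ?_ hfin
    rw [hcard, ← Set.image_univ, Set.ncard_image_of_injective _ hinj, Set.ncard_univ,
      Nat.card_eq_fintype_card, Fintype.card_fin]
  have hsurj : ∀ d ∈ insert x Z, ∃ i, c i = d := fun d hd => by rwa [← hrange] at hd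
  -- The endpoints `c i` exhaust `insert x Z`, so by disjointness each `U i` meets that set in `c i`
  -- alone.
  have hmeet : ∀ i, ∀ d ∈ insert x Z, d ∈ U i → d = c i := by
    intro i d hd hdU
    obtain ⟨j, rfl⟩ := hsurj d hd
    by_contra hne
    exact Set.disjoint_left.1 (hU (fun h : j = i => hne (h ▸ rfl))) (hcU j) hdU
  have hex : ∀ i, ∃ V : Set α, V ⊆ U i ∧ (a i ∈ V ∧
      Relation.ReflTransGen (fun u v => r u v ∧ v ∈ V) (a i) (c i)) ∧
      ∀ v ∈ V, v = c i ∨ Conn r Zᶜ A {v} := by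
    intro i
    refine ⟨{v | v ∈ U i ∧ (v = c i ∨ Conn r Zᶜ A {v})}, fun v hv => hv.1, ?_, fun v hv => hv.2⟩
    have haV : a i = c i ∨ Conn r Zᶜ A {a i} := by
      by_cases h : a i = c i
      · exact Or.inl h
      · exact Or.inr ⟨a i, ha i, a i, rfl, fun h' => h (hmeet i _ (Or.inr h') (haU i)), .refl⟩
    refine ⟨⟨haU i, haV⟩, ?_⟩
    set V : Set α := {v | v ∈ U i ∧ (v = c i ∨ Conn r Zᶜ A {v})} with hV
    have key : ∀ v, Relation.ReflTransGen (fun x y => r x y ∧ y ∈ U i) (a i) v →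
        Relation.ReflTransGen (fun u v => r u v ∧ v ∈ V) (a i) (c i) ∨
        (Conn r Zᶜ A {v} ∧ Relation.ReflTransGen (fun u v => r u v ∧ v ∈ V) (a i) v) := by
      intro v hv
      induction hv with
      | refl =>
        rcases haV with h | h
        · exact Or.inl (h ▸ .refl)
        · exact Or.inr ⟨h, .refl⟩
      | @tail v w _ hvw ih =>
        rcases ih with h | ⟨h1, h2⟩
        · exact Or.inl h
        · by_cases hw : w = c i
          · subst hw
            exact Or.inl (h2.tail ⟨hvw.1, hvw.2, Or.inl rfl⟩)
          · have hwZ : w ∈ Zᶜ := fun h' => hw (hmeet i _ (Or.inr h') hvw.2)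
            obtain ⟨a', ha', v', hv', ha'Z, h3⟩ := h1
            obtain rfl : v' = v := hv'
            have hw' : Conn r Zᶜ A {w} := ⟨a', ha', w, rfl, ha'Z, h3.tail ⟨hvw.1, hwZ⟩⟩
            exact Or.inr ⟨hw', h2.tail ⟨hvw.1, hvw.2, Or.inr hw'⟩⟩
    rcases key _ (hrtg i) with h | h
    · exact h
    · exact h.2
  choose V hVU hVa hVc using hex
  have : Nonempty (Fin k) := (hsurj x (Or.inl rfl)).nonempty
  choose! ind hind using hsurj
  refine ⟨fun d => V (ind d), ?_, ?_, ?_, ?_⟩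
  · intro d hd
    refine ⟨a (ind d), ha _, (hVa _).1, ?_⟩
    have := (hVa (ind d)).2
    rwa [hind d hd] at this
  · intro d hd e he hne
    refine (hU fun h => hne ?_).mono (hVU _) (hVU _)
    rw [← hind d hd, ← hind e he, h]
  · intro d hd v hv
    have := hVc _ v hv
    rwa [hind d hd] at this
  · have hxC : x ∈ insert x Z := Or.inl rfl
    have hsub : U (ind x) ⊆ Zᶜ := by
      intro v hv hvZ
      have h1 := hmeet _ v (Or.inr hvZ) hv
      rw [hind x hxC] at h1
      exact hx (h1 ▸ hvZ)
    have h2 := hrtg (ind x)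
    rw [hind x hxC] at h2
    exact ⟨a (ind x), ha _, x, rfl, hsub (haU _),
      reflTransGen_within_mono h2 (fun _ _ h => h) hsub⟩

/-- Glueing step in Göring's proof of Menger's theorem. -/
theorem exists_glued {α : Type*} {r r' : α → α → Prop} {A B Z : Set α} {x y : α} {k : ℕ}
    (hr' : ∀ u v, r' u v → r u v) (hxy : r x y)
    (hZ : ¬ Conn r' Zᶜ A B) (hZfin : Z.Finite) (hx : x ∉ Z) (hy : y ∉ Z) (hcard : Z.ncard + 1 = k)
    (U W : Fin k → Set α) (hU : Pairwise fun i j => Disjoint (U i) (U j))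
    (hW : Pairwise fun i j => Disjoint (W i) (W j))
    (hUc : ∀ i, Conn r' (U i) A (insert x Z)) (hWc : ∀ i, Conn r' (W i) (insert y Z) B) :
    ∃ P : Fin k → Set α, (Pairwise fun i j => Disjoint (P i) (P j)) ∧ ∀ i, Conn r (P i) A B := by
  have hcx : (insert x Z).ncard = k := by rw [Set.ncard_insert_of_notMem hx hZfin, hcard]
  have hcy : (insert y Z).ncard = k := by rw [Set.ncard_insert_of_notMem hy hZfin, hcard]
  obtain ⟨M, hM1, hM2, hM3, hM4⟩ := exists_trimmed (hZfin.insert x) hcx hx U hU hUc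
  obtain ⟨N, hN1, hN2, hN3, hN4⟩ :=
    exists_trimmed (hZfin.insert y) hcy hy W hW (fun i => (hWc i).swap)
  -- A vertex on both sides would yield an `A`–`B` chain avoiding `Z`. This keeps pieces before and
  -- after the separator disjoint unless they share their label in `Z`.
  have hsep : ∀ v, Conn r' Zᶜ A {v} → Conn (fun u v => r' v u) Zᶜ B {v} → False := by
    rintro v ⟨a, ha, v', hv, haZ, h1⟩ ⟨b, hb, v'', hv', hbZ, h2⟩
    obtain rfl : v' = v := hv
    obtain rfl : v'' = v' := hv'
    exact hZ ⟨a, ha, b, hb, haZ, h1.trans (reflTransGen_within_swap hbZ h2).2⟩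
  have hA : ∀ v, Conn r' Zᶜ A {v} → v ∉ Z := by
    rintro v ⟨a, ha, v', hv, haZ, h1⟩
    obtain rfl : v' = v := hv
    exact (reflTransGen_within_swap haZ h1).1
  have hB : ∀ v, Conn (fun u v => r' v u) Zᶜ B {v} → v ∉ Z := by
    rintro v ⟨a, ha, v', hv, haZ, h1⟩
    obtain rfl : v' = v := hv
    exact (reflTransGen_within_swap haZ h1).1
  classical
  -- The chain ending at `x` continues through the pair `(x, y)`; the other chains continue at the
  -- same element of `Z`.
  let g : α → α := fun c => if c = x then y else c
  have hg : ∀ c ∈ insert x Z, g c ∈ insert y Z := by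
    intro c hc
    by_cases h : c = x
    · simp [g, h]
    · simpa [g, h] using Or.inr (hc.resolve_left h)
  have hginj : ∀ c ∈ insert x Z, ∀ d ∈ insert x Z, c ≠ d → g c ≠ g d := by
    intro c hc d hd hne
    by_cases h : c = x <;> by_cases h' : d = x
    · exact absurd (h.trans h'.symm) hne
    · simp only [g, h, h', if_true, if_false]
      exact fun h2 => hy (h2 ▸ hd.resolve_left h')
    · simp only [g, h, h', if_true, if_false]
      exact fun h2 => hy (h2 ▸ hc.resolve_left h)
    · simpa only [g, h, h', if_false] using hne
  -- description of the elements of the two kinds of pieces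
  have hM : ∀ c ∈ insert x Z, ∀ v ∈ M c, Conn r' Zᶜ A {v} ∨ (v = c ∧ c ∈ Z) := by
    intro c hc v hv
    rcases hM3 c hc v hv with h | h
    · rcases hc with hc | hc
      · exact Or.inl (by rw [h, hc]; exact hM4)
      · exact Or.inr ⟨h, hc⟩
    · exact Or.inl h
  have hN : ∀ c ∈ insert x Z, ∀ v ∈ N (g c),
      Conn (fun u v => r' v u) Zᶜ B {v} ∨ (v = c ∧ c ∈ Z) := by
    intro c hc v hv
    rcases hN3 _ (hg c hc) v hv with h | h
    · by_cases hcx : c = x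
      · exact Or.inl (by simp only [g, hcx, if_true] at h; rw [h]; exact hN4)
      · simp only [g, hcx, if_false] at h
        exact Or.inr ⟨h, hc.resolve_left hcx⟩
    · exact Or.inl h
  have hMN : ∀ c ∈ insert x Z, ∀ d ∈ insert x Z, c ≠ d → Disjoint (M c) (N (g d)) := by
    intro c hc d hd hne
    rw [Set.disjoint_left]
    intro v hv hv'
    rcases hM c hc v hv with h1 | ⟨h1, h2⟩ <;> rcases hN d hd v hv' with h3 | ⟨h3, h4⟩
    · exact hsep v h1 h3
    · exact hA v h1 (h3 ▸ h4)
    · exact hB v h3 (h1 ▸ h2)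
    · exact hne (h1.symm.trans h3)
  have hdisj : ∀ c ∈ insert x Z, ∀ d ∈ insert x Z, c ≠ d →
      Disjoint (M c ∪ N (g c)) (M d ∪ N (g d)) := by
    intro c hc d hd hne
    rw [Set.disjoint_union_left, Set.disjoint_union_right, Set.disjoint_union_right]
    exact ⟨⟨hM2 c hc d hd hne, hMN c hc d hd hne⟩, (hMN d hd c hc hne.symm).symm,
      hN2 _ (hg c hc) _ (hg d hd) (hginj c hc d hd hne)⟩
  have hconn : ∀ c ∈ insert x Z, Conn r (M c ∪ N (g c)) A B := by
    intro c hc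
    obtain ⟨a, ha, haM, h1⟩ := hM1 c hc
    obtain ⟨b, hb, hbN, h2⟩ := hN1 _ (hg c hc)
    obtain ⟨hgN, h2⟩ := reflTransGen_within_swap hbN h2
    refine ⟨a, ha, b, hb, Or.inl haM, ?_⟩
    have h1' := reflTransGen_within_mono (r' := r) h1 hr'
      (Set.subset_union_left (t := N (g c)))
    have h2' := reflTransGen_within_mono (r' := r) h2 hr'
      (Set.subset_union_right (s := M c))
    refine Relation.ReflTransGen.trans h1' ?_
    by_cases h : c = x
    · refine Relation.ReflTransGen.head ⟨?_, Or.inr hgN⟩ h2'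
      simp only [g, h, if_true]
      exact hxy
    · have : g c = c := by simp [g, h]
      rw [this] at h2'
      simpa only [this] using h2'
  have : Finite (insert x Z : Set α) := hZfin.insert x
  have e : Fin k ≃ (insert x Z : Set α) :=
    (Finite.equivFinOfCardEq (by rw [Nat.card_coe_set_eq, hcx])).symm
  exact ⟨fun i => M (e i) ∪ N (g (e i)),
    fun i j hij => hdisj _ (e i).2 _ (e j).2 fun h => hij (e.injective (Subtype.ext h)),
    fun i => hconn _ (e i).2⟩

/-- **Menger's theorem** for a relation with finitely many pairs. -/
theorem menger_of_finite {α : Type*} (n k : ℕ) (r : α → α → Prop) (A B : Set α)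
    (hr : {p : α × α | r p.1 p.2}.Finite) (hn : {p : α × α | r p.1 p.2}.ncard = n)
    (hk : ∀ Z : Set α, Z.Finite → ¬ Conn r Zᶜ A B → k ≤ Z.ncard) :
    ∃ P : Fin k → Set α, (Pairwise fun i j => Disjoint (P i) (P j)) ∧ ∀ i, Conn r (P i) A B := by
  induction n generalizing r A B with
  | zero =>
    have hr0 : ∀ x y, ¬ r x y := by
      rw [Set.ncard_eq_zero hr] at hn
      intro x y h
      have : (x, y) ∈ {p : α × α | r p.1 p.2} := h
      rw [hn] at this
      exact this
    obtain ⟨f, hf⟩ : ∃ f : Fin k → α, Function.Injective f ∧ ∀ i, f i ∈ A ∩ B := by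
      -- Without pairs, chains are single elements of `A ∩ B`, so `A ∩ B` itself is a separator.
      -- `encard` also covers the case where it is infinite.
      have hle : (k : ℕ∞) ≤ (A ∩ B).encard := by
        by_cases hfin : (A ∩ B).Finite
        · rw [← hfin.cast_ncard_eq]
          refine Nat.cast_le.2 (hk _ hfin ?_)
          rintro ⟨a, ha, b, hb, haZ, h⟩
          rcases h.cases_head with rfl | ⟨c, hc, -⟩
          · exact haZ ⟨ha, hb⟩
          · exact hr0 _ _ hc.1
        · rw [Set.not_finite] at hfin
          simp [hfin.encard_eq]
      obtain ⟨t, htAB, ht⟩ := Set.exists_subset_encard_eq hle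
      have htfin : t.Finite := Set.finite_of_encard_eq_coe ht
      have : Finite t := htfin
      have hc : Nat.card t = k := by
        rw [Nat.card_coe_set_eq, Set.ncard, ht]; rfl
      let e := (Finite.equivFinOfCardEq hc).symm
      exact ⟨fun i => e i, Subtype.val_injective.comp e.injective, fun i => htAB (e i).2⟩
    refine ⟨fun i => {f i}, fun i j hij => ?_, fun i => ⟨f i, (hf.2 i).1, f i, (hf.2 i).2, rfl, .refl⟩⟩
    simpa using fun h => hij (hf.1 h)
  | succ n ih =>
    have hne : {p : α × α | r p.1 p.2}.Nonempty := by
      rw [← Set.ncard_pos hr]; omega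
    obtain ⟨⟨x, y⟩, hxy : r x y⟩ := hne
    let r' : α → α → Prop := fun u v => r u v ∧ ¬ (u = x ∧ v = y)
    have hset : {p : α × α | r' p.1 p.2} = {p : α × α | r p.1 p.2} \ {(x, y)} := by
      ext ⟨u, v⟩
      simp [r']
    have hr' : {p : α × α | r' p.1 p.2}.Finite := by rw [hset]; exact hr.sdiff
    have hn' : {p : α × α | r' p.1 p.2}.ncard = n := by
      rw [hset, Set.ncard_sdiff_singleton_of_mem (s := {p : α × α | r p.1 p.2}) hxy, hn]; rfl
    have hsub : ∀ u v, r' u v → r u v := fun _ _ h => h.1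
    by_cases hall : ∀ Z : Set α, Z.Finite → ¬ Conn r' Zᶜ A B → k ≤ Z.ncard
    · obtain ⟨P, hP, hPc⟩ := ih r' A B hr' hn' hall
      exact ⟨P, hP, fun i => (hPc i).mono hsub subset_rfl⟩
    -- Here `Z` separates without `(x, y)` and has fewer than `k` elements, so `insert x Z` and
    -- `insert y Z` are separators of exactly `k` elements. Induction links `A` to the former and
    -- the latter to `B`.
    · push Not at hall
      obtain ⟨Z, hZfin, hZ, hZk⟩ := hall
      let rs : α → α → Prop := fun u v => r v u
      have hZs : ¬ Conn (fun u v => rs u v ∧ ¬ (u = y ∧ v = x)) Zᶜ B A := by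
        intro h
        refine hZ (h.swap.mono (fun u v h => ⟨h.1, fun h' => h.2 ⟨h'.2, h'.1⟩⟩) subset_rfl)
      have hback : ∀ W : Set α, Conn r W A B → Conn r' W (insert y Z) B := by
        intro W h
        exact (Conn.to_separator hZs h.swap).swap.mono
          (fun u v h => ⟨h.1, fun h' => h.2 ⟨h'.2, h'.1⟩⟩) subset_rfl
      have hsepx : k ≤ (insert x Z).ncard := by
        refine hk _ (hZfin.insert x) fun h => ?_
        obtain ⟨a, -, b, hb, ha, h'⟩ := Conn.to_separator hZ h
        exact (reflTransGen_within_swap ha h').1 hb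
      have hsepy : k ≤ (insert y Z).ncard := by
        refine hk _ (hZfin.insert y) fun h => ?_
        obtain ⟨a, ha', b, hb, ha, h'⟩ := hback _ h
        exact ha ha'
      have hx : x ∉ Z := fun h => by rw [Set.insert_eq_of_mem h] at hsepx; omega
      have hy : y ∉ Z := fun h => by rw [Set.insert_eq_of_mem h] at hsepy; omega
      rw [Set.ncard_insert_of_notMem hx hZfin] at hsepx
      obtain ⟨U, hU, hUc⟩ := ih r' A (insert x Z) hr' hn'
        fun W hW hsep => hk W hW fun h => hsep (Conn.to_separator hZ h)
      obtain ⟨W, hW, hWc⟩ := ih r' (insert y Z) B hr' hn'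
        fun W hW hsep => hk W hW fun h => hsep (hback _ h)
      exact exists_glued hsub hxy hZ hZfin hx hy (by omega) U W hU hW hUc hWc

/-! ### Edge version of Menger's theorem -/

/-- `S` and `T` are not joined by a walk of `G` avoiding the edges in `Z`. -/
def VertexSep (G : SimpleGraph V) (S T : Set V) (Z : Set (Sym2 V)) : Prop :=
  ∀ s ∈ S, ∀ t ∈ T, ¬ (G.deleteEdges Z).Reachable s t

/-- The edges of `G` between `X` and its complement. -/
def cut (G : SimpleGraph V) (X : Set V) : Set (Sym2 V) :=
  {e | ∃ u ∈ X, ∃ v ∉ X, G.Adj u v ∧ s(u, v) = e}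

theorem cut_subset_edgeSet (G : SimpleGraph V) (X : Set V) : cut G X ⊆ G.edgeSet := by
  rintro _ ⟨u, -, v, -, h, rfl⟩
  exact h

theorem mem_cut {G : SimpleGraph V} {X : Set V} {u v : V} (h : G.Adj u v) (hu : u ∈ X)
    (hv : v ∉ X) : s(u, v) ∈ cut G X := ⟨u, hu, v, hv, h, rfl⟩

/-- Walks avoiding the boundary of `X` do not leave `X`. -/
theorem mem_of_reachable {G : SimpleGraph V} {X : Set V} {Z : Set (Sym2 V)} (hZ : cut G X ⊆ Z)
    {u v : V} (hu : u ∈ X) (h : (G.deleteEdges Z).Reachable u v) : v ∈ X := by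
  rw [SimpleGraph.reachable_iff_reflTransGen] at h
  induction h with
  | refl => exact hu
  | tail _ hbc ih =>
    by_contra hc
    rw [SimpleGraph.deleteEdges_adj] at hbc
    exact hbc.2 (hZ (mem_cut hbc.1 ih hc))

/-- A set closed under adjacency outside `Z` has its boundary in `Z`. -/
theorem cut_subset_of_closed {G : SimpleGraph V} {X : Set V} {Z : Set (Sym2 V)}
    (h : ∀ u ∈ X, ∀ v, (G.deleteEdges Z).Adj u v → v ∈ X) : cut G X ⊆ Z := by
  rintro _ ⟨u, hu, v, hv, huv, rfl⟩
  by_contra hZ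
  exact hv (h u hu v (by rw [SimpleGraph.deleteEdges_adj]; exact ⟨huv, hZ⟩))

/-- The vertices reachable from `S` after deleting `Z`. -/
def reach (G : SimpleGraph V) (Z : Set (Sym2 V)) (S : Set V) : Set V :=
  {v | ∃ s ∈ S, (G.deleteEdges Z).Reachable s v}

theorem subset_reach (G : SimpleGraph V) (Z : Set (Sym2 V)) (S : Set V) : S ⊆ reach G Z S :=
  fun s hs => ⟨s, hs, .refl s⟩

theorem cut_reach_subset (G : SimpleGraph V) (Z : Set (Sym2 V)) (S : Set V) :
    cut G (reach G Z S) ⊆ Z :=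
  cut_subset_of_closed fun _ ⟨s, hs, h⟩ _ hv => ⟨s, hs, h.trans hv.reachable⟩

theorem vertexSep_cut {G : SimpleGraph V} {S T X : Set V} (hS : S ⊆ X) (hT : Disjoint X T) :
    VertexSep G S T (cut G X) := fun _ hs _ ht h =>
  Set.disjoint_left.1 hT (mem_of_reachable subset_rfl (hS hs) h) ht

/-- Vertex-Menger in the line graph: the points are the edges, related when they share an endpoint,
so deleting points means deleting edges. Disjointness of `S` and `T` guarantees that every
connecting walk has an edge. -/
theorem exists_disjoint_edgeSets {G : SimpleGraph V} (hG : G.edgeSet.Finite) {S T : Set V}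
    (hST : Disjoint S T) (k : ℕ) (hk : ∀ Z, Z.Finite → VertexSep G S T Z → k ≤ Z.ncard) :
    ∃ P : Fin k → Set (Sym2 V), (Pairwise fun i j => Disjoint (P i) (P j)) ∧
      ∀ i, ∃ s ∈ S, ∃ t ∈ T, (SimpleGraph.fromEdgeSet (P i ∩ G.edgeSet)).Reachable s t := by
  let r : Sym2 V → Sym2 V → Prop := fun e f => e ∈ G.edgeSet ∧ f ∈ G.edgeSet ∧ ∃ v, v ∈ e ∧ v ∈ f
  let inc : Set V → Set (Sym2 V) := fun S => {e | e ∈ G.edgeSet ∧ ∃ s ∈ S, s ∈ e}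
  have hr : {p : Sym2 V × Sym2 V | r p.1 p.2}.Finite :=
    (hG.prod hG).subset fun p hp => ⟨hp.1, hp.2.1⟩
  obtain ⟨P, hP, hPc⟩ := menger_of_finite _ k r (inc S) (inc T) hr rfl <| by
    intro Z hZ hsep
    refine hk Z hZ fun s hs t ht hreach => hsep ?_
    rw [SimpleGraph.reachable_iff_reflTransGen] at hreach
    have key : ∀ v, Relation.ReflTransGen (G.deleteEdges Z).Adj s v → v = s ∨
        ∃ a ∈ inc S, ∃ e ∈ G.edgeSet, v ∈ e ∧ a ∈ Zᶜ ∧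
          Relation.ReflTransGen (fun x y => r x y ∧ y ∈ Zᶜ) a e := by
      intro v hv
      induction hv with
      | refl => exact Or.inl rfl
      | @tail v w _ hvw ih =>
        right
        rw [SimpleGraph.deleteEdges_adj] at hvw
        rcases ih with rfl | ⟨a, ha, e, he, hve, haZ, hae⟩
        · exact ⟨s(v, w), ⟨hvw.1, v, hs, by simp⟩, s(v, w), hvw.1, by simp, hvw.2, .refl⟩
        · exact ⟨a, ha, s(v, w), hvw.1, by simp, haZ,
            hae.tail ⟨⟨he, hvw.1, v, hve, by simp⟩, hvw.2⟩⟩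
    rcases key t hreach with rfl | ⟨a, ha, e, he, hve, haZ, hae⟩
    · exact absurd ht (Set.disjoint_left.1 hST hs)
    · exact ⟨a, ha, e, ⟨he, t, ht, hve⟩, haZ, hae⟩
  refine ⟨P, hP, fun i => ?_⟩
  obtain ⟨a, ⟨haE, s, hs, hsa⟩, b, ⟨hbE, t, ht, htb⟩, haP, hab⟩ := hPc i
  have hin : ∀ e ∈ P i ∩ G.edgeSet, ∀ u ∈ e, ∀ v ∈ e,
      (SimpleGraph.fromEdgeSet (P i ∩ G.edgeSet)).Reachable u v := by
    intro e he u hu v hv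
    by_cases huv : u = v
    · rw [huv]
    · have : e = s(u, v) := ((Sym2.mem_and_mem_iff huv).1 ⟨hu, hv⟩)
      exact SimpleGraph.Adj.reachable ((SimpleGraph.fromEdgeSet_adj _).2 ⟨this ▸ he, huv⟩)
  have key : ∀ e, Relation.ReflTransGen (fun x y => r x y ∧ y ∈ P i) a e →
      e ∈ P i ∩ G.edgeSet ∧ ∀ v ∈ e,
        (SimpleGraph.fromEdgeSet (P i ∩ G.edgeSet)).Reachable s v := by
    intro e he
    induction he with
    | refl => exact ⟨⟨haP, haE⟩, fun v hv => hin a ⟨haP, haE⟩ s hsa v hv⟩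
    | @tail e f _ hef ih =>
      obtain ⟨⟨-, hfE, v, hve, hvf⟩, hfP⟩ := hef
      exact ⟨⟨hfP, hfE⟩, fun w hw => (ih.2 v hve).trans (hin f ⟨hfP, hfE⟩ v hvf w hw)⟩
  exact ⟨s, hs, t, ht, (key b hab).2 t htb⟩

/-- Compactness: if the conclusion fails, every finite subgraph has a separator with fewer than `k`
edges. The ultrafilter limit `X` of the sides containing `S` then has fewer than `k` boundary edges
in `G`, and its boundary separates `S` from `T`. -/
theorem exists_disjoint_edgeSets_of_infinite (G : SimpleGraph V) {S T : Set V}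
    (hST : Disjoint S T) (k : ℕ) (hk : ∀ Z, Z.Finite → VertexSep G S T Z → k ≤ Z.ncard) :
    ∃ P : Fin k → Set (Sym2 V), (Pairwise fun i j => Disjoint (P i) (P j)) ∧
      ∀ i, ∃ s ∈ S, ∃ t ∈ T, (SimpleGraph.fromEdgeSet (P i ∩ G.edgeSet)).Reachable s t := by
  classical
  by_contra hcon
  let H : Finset (Sym2 V) → SimpleGraph V := fun E => SimpleGraph.fromEdgeSet (G.edgeSet ∩ E)
  have hHadj : ∀ E u v, (H E).Adj u v ↔ G.Adj u v ∧ s(u, v) ∈ E := by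
    intro E u v
    simp only [H, SimpleGraph.fromEdgeSet_adj, Set.mem_inter_iff, SimpleGraph.mem_edgeSet,
      Finset.mem_coe]
    exact ⟨fun h => h.1, fun h => ⟨h, h.1.ne⟩⟩
  have hHsub : ∀ E, (H E).edgeSet ⊆ G.edgeSet ∩ E := by
    intro E e
    induction e with
    | _ u v => exact fun h => (hHadj E u v).1 h
  have hex : ∀ E : Finset (Sym2 V), ∃ Z : Set (Sym2 V), Z.Finite ∧ VertexSep (H E) S T Z ∧
      Z.ncard < k := by
    intro E
    by_contra hE
    push Not at hE
    obtain ⟨P, hP, hPc⟩ := exists_disjoint_edgeSets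
      (E.finite_toSet.subset fun e he => (hHsub E he).2) hST k hE
    refine hcon ⟨P, hP, fun i => ?_⟩
    obtain ⟨s, hs, t, ht, h⟩ := hPc i
    exact ⟨s, hs, t, ht, h.mono (SimpleGraph.fromEdgeSet_mono
      (Set.inter_subset_inter_right _ fun e he => (hHsub E he).1))⟩
  choose Z hZfin hZsep hZk using hex
  let U : Ultrafilter (Finset (Sym2 V)) := Ultrafilter.of Filter.atTop
  let X : Set V := {v | ∀ᶠ E in (U : Filter (Finset (Sym2 V))), v ∈ reach (H E) (Z E) S}
  have hcut : ∀ Q : Finset (Sym2 V), (Q : Set (Sym2 V)) ⊆ cut G X → Q.card < k := by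
    intro Q hQ
    -- For almost all `E`, the edge belongs to `H E` and its two ends lie on different sides of the
    -- separator, so it belongs to `Z E`.
    have hev : ∀ e ∈ Q, ∀ᶠ E in (U : Filter (Finset (Sym2 V))), e ∈ Z E := by
      intro e he
      obtain ⟨u, hu, v, hv, huv, rfl⟩ := hQ he
      have hv' : ∀ᶠ E in (U : Filter (Finset (Sym2 V))), v ∉ reach (H E) (Z E) S :=
        Ultrafilter.eventually_not.2 hv
      have hE : ∀ᶠ E in (U : Filter (Finset (Sym2 V))), {s(u, v)} ≤ E :=
        (Filter.eventually_ge_atTop _).filter_mono (Ultrafilter.of_le _)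
      filter_upwards [hu, hv', hE] with E h1 h2 h3
      exact cut_reach_subset (H E) (Z E) S
        (mem_cut ((hHadj E u v).2 ⟨huv, h3 (Finset.mem_singleton_self _)⟩) h1 h2)
    obtain ⟨E, hE⟩ := ((Filter.eventually_all_finset Q).2 hev).exists
    refine lt_of_le_of_lt ?_ (hZk E)
    rw [← Set.ncard_coe_finset]
    exact Set.ncard_le_ncard hE (hZfin E)
  have hfin : (cut G X).Finite := by
    by_contra hinf
    obtain ⟨Q, hQ, hQk⟩ := Set.Infinite.exists_subset_card_eq hinf k
    exact absurd (hcut Q hQ) (by omega)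
  have hlt : (cut G X).ncard < k := by
    rw [Set.ncard_eq_toFinset_card _ hfin]
    exact hcut _ (by simp)
  refine absurd (hk _ hfin (vertexSep_cut ?_ ?_)) (by omega)
  · exact fun s hs => Filter.Eventually.of_forall fun E => subset_reach _ _ _ hs
  · rw [Set.disjoint_left]
    intro v hv hvT
    obtain ⟨E, s, hs, h⟩ := Filter.Eventually.exists hv
    exact hZsep E s hs v hvT h

/-- **Menger's theorem**, edge version with finitely many walks in an arbitrary graph. -/
theorem exists_disjoint_walks (G : SimpleGraph V) {S T : Set V}
    (hST : Disjoint S T) (k : ℕ) (hk : ∀ Z, Z.Finite → VertexSep G S T Z → k ≤ Z.ncard) :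
    ∃ (s t : Fin k → V) (p : ∀ i, G.Walk (s i) (t i)), (∀ i, s i ∈ S) ∧ (∀ i, t i ∈ T) ∧
      Pairwise fun i j => ∀ e ∈ (p i).edges, e ∉ (p j).edges := by
  obtain ⟨P, hP, hPc⟩ := exists_disjoint_edgeSets_of_infinite G hST k hk
  have : ∀ i, ∃ (s t : V) (p : G.Walk s t), s ∈ S ∧ t ∈ T ∧ ∀ e ∈ p.edges, e ∈ P i := by
    intro i
    obtain ⟨s, hs, t, ht, ⟨q⟩⟩ := hPc i
    have hle : SimpleGraph.fromEdgeSet (P i ∩ G.edgeSet) ≤ G := by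
      intro u v h
      exact ((SimpleGraph.fromEdgeSet_adj _).1 h).1.2
    refine ⟨s, t, q.mapLe hle, hs, ht, fun e he => ?_⟩
    rw [SimpleGraph.Walk.edges_mapLe_eq_edges] at he
    have := q.edges_subset_edgeSet he
    rw [SimpleGraph.edgeSet_fromEdgeSet] at this
    exact this.1.1
  choose s t p hs ht hp using this
  exact ⟨s, t, p, hs, ht, fun i j hij e he he' =>
    Set.disjoint_left.1 (hP hij) (hp i e he) (hp j e he')⟩

/-! ### Rays, ends, and the components in which they live -/

/-- The vertices lying, after deleting `Z`, in the component of a tail of `r`. -/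
def Ray.comp {G : SimpleGraph V} (r : Ray G) (Z : Set (Sym2 V)) : Set V :=
  {v | ∀ᶠ i in Filter.atTop, (G.deleteEdges Z).Reachable v (r.vert i)}

theorem Ray.cut_comp_subset {G : SimpleGraph V} (r : Ray G) (Z : Set (Sym2 V)) :
    cut G (r.comp Z) ⊆ Z :=
  cut_subset_of_closed fun _ hu _ hv => hu.mono fun _ h => hv.reachable.symm.trans h

theorem Ray.mem_comp_of_reachable {G : SimpleGraph V} (r : Ray G) {Z : Set (Sym2 V)} {u v : V}
    (hu : u ∈ r.comp Z) (h : (G.deleteEdges Z).Reachable u v) : v ∈ r.comp Z :=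
  hu.mono fun _ h' => h.symm.trans h'

theorem Ray.reachable_of_mem_comp {G : SimpleGraph V} (r : Ray G) {Z : Set (Sym2 V)} {u v : V}
    (hu : u ∈ r.comp Z) (hv : v ∈ r.comp Z) : (G.deleteEdges Z).Reachable u v := by
  obtain ⟨i, h1, h2⟩ := (Filter.Eventually.and hu hv).exists
  exact h1.trans h2.symm

theorem Ray.comp_anti {G : SimpleGraph V} (r : Ray G) {Z Z' : Set (Sym2 V)} (h : Z ⊆ Z') :
    r.comp Z' ⊆ r.comp Z :=
  fun _ hv => hv.mono fun _ h' => h'.mono (SimpleGraph.deleteEdges_anti h)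

theorem Ray.hasTailIn_iff {G : SimpleGraph V} (r : Ray G) {Z : Set (Sym2 V)} (v : V) :
    r.HasTailIn ((G.deleteEdges Z).connectedComponentMk v) ↔ v ∈ r.comp Z := by
  simp only [Ray.HasTailIn, Ray.comp, Set.mem_ofPred_eq, Filter.eventually_atTop,
    SimpleGraph.ConnectedComponent.mem_supp_iff, SimpleGraph.ConnectedComponent.eq,
    SimpleGraph.reachable_comm]

theorem Ray.eventually_mem_comp {G : SimpleGraph V} (r : Ray G) {Z : Set (Sym2 V)}
    (hZ : Z.Finite) : ∀ᶠ i in Filter.atTop, r.vert i ∈ r.comp Z := by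
  obtain ⟨C, n, hn⟩ := r.exists_hasTailIn hZ
  refine Filter.eventually_atTop.2 ⟨n, fun i hi => ?_⟩
  rw [← Ray.hasTailIn_iff]
  have : (G.deleteEdges Z).connectedComponentMk (r.vert i) = C :=
    (SimpleGraph.ConnectedComponent.mem_supp_iff _ _).1 (hn i hi)
  exact this ▸ ⟨n, hn⟩

theorem Ray.edgeEnd_eq_iff {G : SimpleGraph V} (r s : Ray G) :
    r.edgeEnd = s.edgeEnd ↔
      ∀ Z : Set (Sym2 V), Z.Finite → Z ⊆ G.edgeSet → ∀ᶠ i in Filter.atTop, s.vert i ∈ r.comp Z := by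
  have heq : r.edgeEnd = s.edgeEnd ↔ EdgeEquiv G r s := Quotient.eq (r := edgeSetoid G)
  rw [heq]
  constructor
  · intro h Z hZ hZG
    obtain ⟨C, hr, n, hn⟩ := h Z hZ hZG
    refine Filter.eventually_atTop.2 ⟨n, fun i hi => ?_⟩
    rw [← Ray.hasTailIn_iff]
    have : (G.deleteEdges Z).connectedComponentMk (s.vert i) = C :=
      (SimpleGraph.ConnectedComponent.mem_supp_iff _ _).1 (hn i hi)
    exact this ▸ hr
  · intro h Z hZ hZG
    obtain ⟨i, h1, h2⟩ := ((h Z hZ hZG).and (s.eventually_mem_comp hZ)).exists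
    exact ⟨_, (r.hasTailIn_iff _).2 h1, (s.hasTailIn_iff _).2 h2⟩

/-- If `X` has finite boundary, each ray has a tail in `X` or in its complement. -/
theorem Ray.eventually_mem_or {G : SimpleGraph V} (r : Ray G) {X : Set V}
    (hX : (cut G X).Finite) :
    (∀ᶠ i in Filter.atTop, r.vert i ∈ X) ∨ ∀ᶠ i in Filter.atTop, r.vert i ∉ X := by
  by_cases h : ∃ v ∈ r.comp (cut G X), v ∈ X
  · obtain ⟨v, hv, hvX⟩ := h
    exact Or.inl (hv.mono fun i hi => mem_of_reachable subset_rfl hvX hi)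
  · push Not at h
    exact Or.inr ((r.eventually_mem_comp hX).mono fun i hi => h _ hi)

/-- Membership in a set with finite boundary depends only on the edge-end. -/
theorem Ray.eventually_mem_congr {G : SimpleGraph V} {r s : Ray G} (h : r.edgeEnd = s.edgeEnd)
    {X : Set V} (hX : (cut G X).Finite) (hr : ∀ᶠ i in Filter.atTop, r.vert i ∈ X) :
    ∀ᶠ i in Filter.atTop, s.vert i ∈ X := by
  have h1 := (r.edgeEnd_eq_iff s).1 h _ hX (cut_subset_edgeSet G X)
  obtain ⟨j, hj, hj'⟩ := (hr.and (r.eventually_mem_comp hX)).exists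
  exact h1.mono fun i hi => mem_of_reachable subset_rfl hj (r.reachable_of_mem_comp hj' hi)

/-- Lets the restriction to subsets of `G.edgeSet` in the definition of domination be ignored. -/
theorem deleteEdges_inter_edgeSet (G : SimpleGraph V) (Z : Set (Sym2 V)) :
    G.deleteEdges (Z ∩ G.edgeSet) = G.deleteEdges Z := by
  ext u v
  simp only [SimpleGraph.deleteEdges_adj, Set.mem_inter_iff, SimpleGraph.mem_edgeSet]
  tauto

theorem EdgeDominates.mem_comp {G : SimpleGraph V} {v : V} {r : Ray G}
    (h : EdgeDominates G v r.edgeEnd) {Z : Set (Sym2 V)} (hZ : Z.Finite) : v ∈ r.comp Z := by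
  have := (r.hasTailIn_iff v).1 (h r rfl _ (hZ.inter_of_left G.edgeSet) Set.inter_subset_right)
  rwa [Ray.comp, deleteEdges_inter_edgeSet] at this

/-- Testing the single ray `r` suffices, since equivalent rays have tails in the same component
after every finite deletion. -/
theorem exists_notMem_comp {G : SimpleGraph V} {v : V} {r : Ray G}
    (h : ¬ EdgeDominates G v r.edgeEnd) : ∃ Z : Set (Sym2 V), Z.Finite ∧ v ∉ r.comp Z := by
  by_contra hcon
  push Not at hcon
  refine h fun s hs Z hZ hZG => ?_
  obtain ⟨i, h1, h2⟩ := (((r.edgeEnd_eq_iff s).1 hs.symm Z hZ hZG).and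
    (s.eventually_mem_comp hZ)).exists
  rw [Ray.hasTailIn_iff]
  exact s.mem_comp_of_reachable h2 (r.reachable_of_mem_comp h1 (hcon Z hZ))

/-- Distinct ends live in distinct components after deleting some finite edge set. -/
theorem exists_disjoint_comp {G : SimpleGraph V} {r s : Ray G} (h : r.edgeEnd ≠ s.edgeEnd) :
    ∃ Z : Set (Sym2 V), Z.Finite ∧ ∀ Z', Z ⊆ Z' → Disjoint (r.comp Z') (s.comp Z') := by
  by_contra hcon
  push Not at hcon
  refine h ((r.edgeEnd_eq_iff s).2 fun Z hZ _ => ?_)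
  obtain ⟨Z', hZZ', hZ'⟩ := hcon Z hZ
  obtain ⟨v, hv, hv'⟩ := Set.not_disjoint_iff.1 hZ'
  exact (s.eventually_mem_comp hZ).mono fun i hi => r.mem_comp_of_reachable
    (r.comp_anti hZZ' hv) (s.reachable_of_mem_comp (s.comp_anti hZZ' hv') hi)

/-! ### Changing initial segments of rays -/

theorem Ray.edgeEnd_eq_of_reindex {G : SimpleGraph V} (r s : Ray G) (φ : ℕ → ℕ)
    (hφ : Filter.Tendsto φ Filter.atTop Filter.atTop)
    (h : ∀ᶠ i in Filter.atTop, s.vert i = r.vert (φ i)) : s.edgeEnd = r.edgeEnd := by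
  refine ((r.edgeEnd_eq_iff s).2 fun Z hZ _ => ?_).symm
  filter_upwards [h, hφ.eventually (r.eventually_mem_comp hZ)] with i h1 h2
  rwa [h1]

/-- The tail of a ray from its `n`-th vertex on. -/
def Ray.shift {G : SimpleGraph V} (r : Ray G) (n : ℕ) : Ray G where
  vert i := r.vert (n + i)
  inj i j h := by simpa using r.inj h
  adj i := r.adj (n + i)

theorem Ray.edgeEnd_shift {G : SimpleGraph V} (r : Ray G) (n : ℕ) :
    (r.shift n).edgeEnd = r.edgeEnd :=
  Ray.edgeEnd_eq_of_reindex _ _ (fun i => n + i)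
    (Filter.tendsto_atTop_mono (fun i => Nat.le_add_left i n) Filter.tendsto_id)
    (Filter.Eventually.of_forall fun _ => rfl)

theorem Ray.edges_shift_subset {G : SimpleGraph V} (r : Ray G) (n : ℕ) :
    (r.shift n).edges ⊆ r.edges := by
  rintro _ ⟨i, rfl⟩
  exact ⟨n + i, rfl⟩

/-- Extension of a ray by a new first vertex. -/
def Ray.cons {G : SimpleGraph V} (r : Ray G) (u : V) (h : G.Adj u (r.vert 0))
    (hu : ∀ i, r.vert i ≠ u) : Ray G where
  vert i := Nat.casesOn i u r.vert
  inj i j hij := by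
    cases i <;> cases j
    · rfl
    · exact absurd hij.symm (hu _)
    · exact absurd hij (hu _)
    · exact congrArg _ (r.inj hij)
  adj i := by
    cases i
    · exact h
    · exact r.adj _

theorem Ray.edgeEnd_cons {G : SimpleGraph V} (r : Ray G) (u : V) (h : G.Adj u (r.vert 0))
    (hu : ∀ i, r.vert i ≠ u) : (r.cons u h hu).edgeEnd = r.edgeEnd := by
  refine Ray.edgeEnd_eq_of_reindex _ _ (fun i => i - 1) (Filter.tendsto_sub_atTop_nat 1) ?_
  filter_upwards [Filter.eventually_ge_atTop 1] with i hi
  obtain ⟨i, rfl⟩ := Nat.exists_eq_add_of_le' hi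
  rfl

/-- A walk leading to the start of a ray can be combined with the ray to a ray. -/
theorem Ray.exists_prepend {G : SimpleGraph V} {u v : V} (p : G.Walk u v) (r : Ray G)
    (hr : r.vert 0 = v) :
    ∃ r' : Ray G, r'.vert 0 = u ∧ r'.edgeEnd = r.edgeEnd ∧
      ∀ e ∈ r'.edges, e ∈ p.edges ∨ e ∈ r.edges := by
  induction p with
  | nil => exact ⟨r, hr, rfl, fun e he => Or.inr he⟩
  | @cons u v w h p ih =>
    obtain ⟨r', h0, hend, hedges⟩ := ih hr
    -- If the new vertex already lies on the ray, the ray is shortened to start there, which keeps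
    -- its vertices distinct.
    by_cases hu : ∃ i, r'.vert i = u
    · obtain ⟨i, hi⟩ := hu
      refine ⟨r'.shift i, hi, (r'.edgeEnd_shift i).trans hend, fun e he => ?_⟩
      rcases hedges e (r'.edges_shift_subset i he) with h' | h'
      · exact Or.inl (by simp [h'])
      · exact Or.inr h'
    · push Not at hu
      refine ⟨r'.cons u (h0 ▸ h) hu, rfl, (r'.edgeEnd_cons _ _ _).trans hend, ?_⟩
      rintro _ ⟨i, rfl⟩
      cases i with
      | zero =>
        left
        have : s((r'.cons u (h0 ▸ h) hu).vert 0, (r'.cons u (h0 ▸ h) hu).vert (0 + 1)) = s(u, v) :=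
          congrArg (fun z => s(u, z)) h0
        simp [this]
      | succ i =>
        rcases hedges _ ⟨i, rfl⟩ with h' | h'
        · exact Or.inl (by rw [SimpleGraph.Walk.edges_cons]; exact List.mem_cons_of_mem _ h')
        · exact Or.inr h'

/-! ### Infinite walks -/

/-- Loop erasure of an infinite walk that visits each vertex finitely often. -/
theorem exists_ray_of_infinite_walk {G : SimpleGraph V} (w : ℕ → V)
    (hw : ∀ i, G.Adj (w i) (w (i + 1))) (hfin : ∀ v, {i | w i = v}.Finite) :
    ∃ (r : Ray G) (φ : ℕ → ℕ), Filter.Tendsto φ Filter.atTop Filter.atTop ∧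
      (∀ i, r.vert i = w (φ i)) ∧ r.vert 0 = w 0 ∧
      ∀ e ∈ r.edges, ∃ i, e = s(w i, w (i + 1)) := by
  have hlast : ∀ i, ∃ j, i ≤ j ∧ w j = w i ∧ ∀ l, w l = w i → l ≤ j := by
    intro i
    obtain ⟨j, hj, hmax⟩ := Set.exists_max_image _ id (hfin (w i)) ⟨i, rfl⟩
    exact ⟨j, hmax i rfl, hj, hmax⟩
  choose L hL1 hL2 hL3 using hlast
  -- `L i` is the time of the last visit to `w i`. From each last visit take one step, then jump to
  -- the last visit of the vertex reached; no vertex can recur.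
  let φ : ℕ → ℕ := fun n => Nat.rec (L 0) (fun _ a => L (a + 1)) n
  have hφ : ∀ n, φ (n + 1) = L (φ n + 1) := fun _ => rfl
  have hmono : StrictMono φ := strictMono_nat_of_lt_succ fun n => by
    rw [hφ]; exact hL1 (φ n + 1)
  have hφlast : ∀ n l, w l = w (φ n) → l ≤ φ n := by
    intro n l h
    cases n with
    | zero => exact hL3 0 l (h.trans (hL2 0))
    | succ n => exact hL3 _ l (h.trans (hL2 (φ n + 1)))
  have hstep : ∀ n, w (φ (n + 1)) = w (φ n + 1) := fun n => hL2 (φ n + 1)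
  let r : Ray G :=
    { vert := fun n => w (φ n)
      inj := by
        intro m n h
        exact hmono.injective (le_antisymm (hφlast n _ h) (hφlast m _ h.symm))
      adj := fun n => by rw [hstep]; exact hw _ }
  refine ⟨r, φ, hmono.tendsto_atTop, fun _ => rfl, hL2 0, ?_⟩
  rintro _ ⟨i, rfl⟩
  exact ⟨φ i, by simp only [r, hstep]⟩

theorem mk_getVert_mem_edges {G : SimpleGraph V} {u v : V} (p : G.Walk u v) {i : ℕ}
    (hi : i < p.length) : s(p.getVert i, p.getVert (i + 1)) ∈ p.edges := by
  induction p generalizing i with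
  | nil => exact absurd hi (Nat.not_lt_zero _)
  | cons h p ih =>
    cases i with
    | zero => simp
    | succ i =>
      rw [SimpleGraph.Walk.edges_cons]
      exact List.mem_cons_of_mem _ (ih (by simpa using hi))

/-- Concatenation of infinitely many walks. -/
theorem exists_infinite_concat {G : SimpleGraph V} (y : ℕ → V)
    (q : ∀ n, G.Walk (y n) (y (n + 1))) (hq : ∀ n, 0 < (q n).length) :
    ∃ w : ℕ → V, w 0 = y 0 ∧ (∀ i, G.Adj (w i) (w (i + 1))) ∧
      (∀ i, ∃ n, s(w i, w (i + 1)) ∈ (q n).edges) ∧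
      ∀ N, ∀ᶠ i in Filter.atTop, ∃ n, N ≤ n ∧ w i ∈ (q n).support := by
  let W : ∀ n, G.Walk (y 0) (y n) := fun n => Nat.rec .nil (fun n p => p.append (q n)) n
  have hW : ∀ n, W (n + 1) = (W n).append (q n) := fun _ => rfl
  have hlen : ∀ n, (W (n + 1)).length = (W n).length + (q n).length := fun n => by
    rw [hW, SimpleGraph.Walk.length_append]
  have hmono : StrictMono fun n => (W n).length := strictMono_nat_of_lt_succ fun n => by
    rw [hlen]; have := hq n; omega
  have hstep : ∀ n i, i ≤ (W n).length → (W (n + 1)).getVert i = (W n).getVert i := by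
    intro n i hi
    rw [hW, SimpleGraph.Walk.getVert_append]
    split_ifs with h
    · rfl
    · have : i = (W n).length := by omega
      subst this
      simp
  have hco : ∀ n m i, n ≤ m → i ≤ (W n).length → (W m).getVert i = (W n).getVert i := by
    intro n m i hnm hi
    induction m, hnm using Nat.le_induction with
    | base => rfl
    | succ m hm ih => rw [hstep m i (hi.trans (hmono.monotone hm)), ih]
  have hid : ∀ n, n ≤ (W n).length := fun n => hmono.id_le n
  -- Every piece has positive length, so `W i` has length at least `i` and its `i`-th vertex no
  -- longer changes as pieces are added.
  let w : ℕ → V := fun i => (W i).getVert i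
  have hw : ∀ n i, i ≤ (W n).length → w i = (W n).getVert i := by
    intro n i hi
    rcases le_total n i with h | h
    · exact hco n i i h hi
    · exact (hco i n i h (hid i)).symm
  have hpos : ∀ i, ∃ n, (W n).length ≤ i ∧ i < (W (n + 1)).length := by
    intro i
    have hex : ∃ n, i < (W n).length := ⟨i + 1, hid (i + 1)⟩
    classical
    have h0 : Nat.find hex ≠ 0 := fun h => by
      have := Nat.find_spec hex
      rw [h] at this
      exact absurd this (Nat.not_lt_zero _)
    obtain ⟨n, hn⟩ := Nat.exists_eq_succ_of_ne_zero h0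
    refine ⟨n, not_lt.1 (Nat.find_min hex (by omega)), ?_⟩
    have := Nat.find_spec hex
    rwa [hn] at this
  have hget : ∀ n i, (W n).length ≤ i → i ≤ (W (n + 1)).length →
      w i = (q n).getVert (i - (W n).length) := by
    intro n i h1 h2
    rw [hw (n + 1) i h2, hW, SimpleGraph.Walk.getVert_append, if_neg (not_lt.2 h1)]
  have hedge : ∀ n i, (W n).length ≤ i → i < (W (n + 1)).length →
      s(w i, w (i + 1)) ∈ (q n).edges := by
    intro n i h1 h2
    rw [hget n i h1 h2.le, hget n (i + 1) (by omega) h2, Nat.sub_add_comm h1]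
    rw [hlen] at h2
    exact mk_getVert_mem_edges _ (by omega)
  refine ⟨w, ?_, ?_, ?_, ?_⟩
  · rfl
  · intro i
    obtain ⟨n, h1, h2⟩ := hpos i
    exact (q n).edges_subset_edgeSet (hedge n i h1 h2)
  · intro i
    obtain ⟨n, h1, h2⟩ := hpos i
    exact ⟨n, hedge n i h1 h2⟩
  · intro N
    filter_upwards [Filter.eventually_ge_atTop (W N).length] with i hi
    obtain ⟨n, h1, h2⟩ := hpos i
    refine ⟨n, ?_, ?_⟩
    · by_contra h
      have := hmono.monotone (show n + 1 ≤ N by omega)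
      omega
    · rw [hget n i h1 h2.le]
      exact SimpleGraph.Walk.getVert_mem_support _ _

/-- The initial piece of a walk up to its first vertex in `T`. -/
theorem exists_first_hit {G : SimpleGraph V} {T : Set V} {u v : V} (p : G.Walk u v) (hu : u ∉ T)
    (hv : v ∈ T) :
    ∃ (x y : V) (q : G.Walk u x), x ∉ T ∧ y ∈ T ∧ G.Adj x y ∧ s(x, y) ∈ p.edges ∧
      (∀ z ∈ q.support, z ∉ T) ∧ q.edges ⊆ p.edges := by
  induction p with
  | nil => exact absurd hv hu
  | @cons u w v h p ih =>
    by_cases hw : w ∈ T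
    · exact ⟨u, w, .nil, hu, hw, h, by simp, by simpa using hu, by simp⟩
    · obtain ⟨x, y, q, hx, hy, hxy, hmem, hsupp, hsub⟩ := ih hw hv
      refine ⟨x, y, .cons h q, hx, hy, hxy, ?_, ?_, ?_⟩
      · rw [SimpleGraph.Walk.edges_cons]; exact List.mem_cons_of_mem _ hmem
      · intro z hz
        rw [SimpleGraph.Walk.support_cons] at hz
        rcases List.mem_cons.1 hz with rfl | hz
        · exact hu
        · exact hsupp z hz
      · rw [SimpleGraph.Walk.edges_cons, SimpleGraph.Walk.edges_cons]
        exact List.cons_subset_cons _ hsub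

/-! ### Finite cuts between vertices and ends -/

/-- `X` contains `S`, has finite boundary, and no ray with edge-end in `A` has a tail in `X`. -/
structure EndCut (G : SimpleGraph V) (S : Set V) (A : Set (EdgeEnd G)) (X : Set V) : Prop where
  subset : S ⊆ X
  finite : (cut G X).Finite
  eventually : ∀ r : Ray G, r.edgeEnd ∈ A → ∀ᶠ i in Filter.atTop, r.vert i ∉ X

theorem EndCut.mono {G : SimpleGraph V} {S : Set V} {A B : Set (EdgeEnd G)} {X : Set V}
    (h : EndCut G S A X) (hBA : B ⊆ A) : EndCut G S B X :=
  ⟨h.subset, h.finite, fun r hr => h.eventually r (hBA hr)⟩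

/-- A path avoiding the boundary stays in `X`. A ray of `A` cannot do so, and a dominating vertex in
`X` would force tails of its end into `X`. -/
theorem EndCut.separates {G : SimpleGraph V} {S : Set V} {A : Set (EdgeEnd G)} {X : Set V}
    (h : EndCut G S A X) : Separates G S A (cut G X) := by
  intro P hP
  cases P with
  | ray r hs he =>
    have hX : ∀ i, r.vert i ∈ X := by
      intro i
      induction i with
      | zero => exact h.subset hs
      | succ i ih =>
        by_contra hi
        exact Set.disjoint_left.1 hP ⟨i, rfl⟩ (mem_cut (r.adj i) ih hi)
    obtain ⟨i, hi⟩ := (h.eventually r he).exists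
    exact hi (hX i)
  | @finite u v p _ hs hd =>
    obtain ⟨ω, hω, hd⟩ := hd
    obtain ⟨r, rfl⟩ : ∃ r : Ray G, r.edgeEnd = ω := Quotient.exists_rep ω
    have hv : v ∈ X := mem_of_reachable subset_rfl (h.subset hs)
      ⟨p.toDeleteEdges (cut G X) fun e he => Set.disjoint_left.1 hP he⟩
    obtain ⟨i, hi, hi'⟩ := (Filter.Eventually.and (hd.mem_comp h.finite) (h.eventually r hω)).exists
    exact hi' (mem_of_reachable subset_rfl hv hi)

/-- A ray of `A` with a tail in the reachable set has a tail avoiding the finite set `F`; joining it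
to `S` outside `F` would give an unseparated ray. -/
theorem Separates.endCut_reach {G : SimpleGraph V} {S : Set V} {A : Set (EdgeEnd G)}
    {F : Set (Sym2 V)} (hF : F.Finite) (h : Separates G S A F) : EndCut G S A (reach G F S) := by
  have hcut := hF.subset (cut_reach_subset G F S)
  refine ⟨subset_reach G F S, hcut, fun r hr => (r.eventually_mem_or hcut).resolve_left ?_⟩
  intro hev
  have hlarge : ∀ᶠ n in Filter.atTop, ∀ i, n ≤ i → s(r.vert i, r.vert (i + 1)) ∉ F := by
    have hfin : {i | s(r.vert i, r.vert (i + 1)) ∈ F}.Finite := hF.preimage r.edge_injective.injOn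
    obtain ⟨N, hN⟩ := hfin.bddAbove
    filter_upwards [Filter.eventually_gt_atTop N] with n hn i hi hiF
    have := hN hiF
    omega
  obtain ⟨n, ⟨s, hs, ⟨p⟩⟩, hn⟩ := (hev.and hlarge).exists
  obtain ⟨r', h0, hend, hedges⟩ := Ray.exists_prepend (p.mapLe (G.deleteEdges_le F))
    (r.shift n) rfl
  refine h (.ray r' (h0 ▸ hs) (by rw [hend, r.edgeEnd_shift]; exact hr)) ?_
  rw [Set.disjoint_left]
  intro e he heF
  rcases hedges e he with h' | ⟨i, rfl⟩
  · rw [SimpleGraph.Walk.edges_mapLe_eq_edges] at h'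
    have := p.edges_subset_edgeSet h'
    rw [SimpleGraph.edgeSet_deleteEdges] at this
    exact this.2 heF
  · exact hn (n + i) (Nat.le_add_right n i) heF

theorem cut_inter_union_subset (G : SimpleGraph V) (X Y : Set V) :
    cut G (X ∩ Y) ∪ cut G (X ∪ Y) ⊆ cut G X ∪ cut G Y := by
  rintro _ (⟨u, hu, v, hv, h, rfl⟩ | ⟨u, hu, v, hv, h, rfl⟩)
  · by_cases hvX : v ∈ X
    · exact Or.inr (mem_cut h hu.2 fun hvY => hv ⟨hvX, hvY⟩)
    · exact Or.inl (mem_cut h hu.1 hvX)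
  · rcases hu with hu | hu
    · exact Or.inl (mem_cut h hu fun h' => hv (Or.inl h'))
    · exact Or.inr (mem_cut h hu fun h' => hv (Or.inr h'))

/-- An edge in both boundaries joins `X ∩ Y` to the complement of `X ∪ Y`, so it crosses both sets.
Thus no edge is counted more often on the left of the submodular inequality than on the right. -/
theorem cut_inter_inter_subset (G : SimpleGraph V) (X Y : Set V) :
    cut G (X ∩ Y) ∩ cut G (X ∪ Y) ⊆ cut G X ∩ cut G Y := by
  rintro _ ⟨⟨u, hu, v, hv, h, rfl⟩, ⟨u', hu', v', hv', h', huv⟩⟩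
  have hvn : v ∉ X ∪ Y := by
    rcases Sym2.eq_iff.1 huv with ⟨-, rfl⟩ | ⟨-, rfl⟩
    · exact hv'
    · exact absurd (Or.inl hu.1) hv'
  exact ⟨mem_cut h hu.1 fun h => hvn (Or.inl h), mem_cut h hu.2 fun h => hvn (Or.inr h)⟩

/-- Submodularity of the size of edge boundaries. -/
theorem ncard_cut_inter_add_ncard_cut_union_le {G : SimpleGraph V} {X Y : Set V}
    (hX : (cut G X).Finite) (hY : (cut G Y).Finite) :
    (cut G (X ∩ Y)).ncard + (cut G (X ∪ Y)).ncard ≤ (cut G X).ncard + (cut G Y).ncard := by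
  have hfin := (hX.union hY).subset (cut_inter_union_subset G X Y)
  rw [← Set.ncard_union_add_ncard_inter _ _ (hfin.subset Set.subset_union_left)
    (hfin.subset Set.subset_union_right), ← Set.ncard_union_add_ncard_inter _ _ hX hY]
  exact add_le_add (Set.ncard_le_ncard (cut_inter_union_subset G X Y) (hX.union hY))
    (Set.ncard_le_ncard (cut_inter_inter_subset G X Y) (hX.inter_of_left _))

theorem EndCut.inter {G : SimpleGraph V} {S : Set V} {A : Set (EdgeEnd G)} {X Y : Set V}
    (hX : EndCut G S A X) (hY : EndCut G S A Y) : EndCut G S A (X ∩ Y) :=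
  ⟨Set.subset_inter hX.subset hY.subset,
    ((hX.finite.union hY.finite).subset (cut_inter_union_subset G X Y)).subset
      Set.subset_union_left,
    fun r hr => (hX.eventually r hr).mono fun _ h h' => h h'.1⟩

theorem EndCut.union {G : SimpleGraph V} {S : Set V} {A : Set (EdgeEnd G)} {X Y : Set V}
    (hX : EndCut G S A X) (hY : EndCut G S A Y) : EndCut G S A (X ∪ Y) :=
  ⟨hX.subset.trans Set.subset_union_left,
    ((hX.finite.union hY.finite).subset (cut_inter_union_subset G X Y)).subset
      Set.subset_union_right,
    fun r hr => ((hX.eventually r hr).and (hY.eventually r hr)).mono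
      fun _ h h' => h'.elim h.1 h.2⟩

/-- The boundary of the intersection of a family of sets closed under intersection is no larger
than the boundaries of the sets. -/
theorem ncard_cut_sInter_le {G : SimpleGraph V} {𝓧 : Set (Set V)} (hne : 𝓧.Nonempty)
    (hinter : ∀ X ∈ 𝓧, ∀ Y ∈ 𝓧, X ∩ Y ∈ 𝓧) {m : ℕ}
    (hfin : ∀ X ∈ 𝓧, (cut G X).Finite) (hm : ∀ X ∈ 𝓧, (cut G X).ncard ≤ m) :
    (cut G (⋂₀ 𝓧)).Finite ∧ (cut G (⋂₀ 𝓧)).ncard ≤ m := by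
  classical
  have hcard : ∀ Q : Finset (Sym2 V), (Q : Set (Sym2 V)) ⊆ cut G (⋂₀ 𝓧) → Q.card ≤ m := by
    intro Q hQ
    -- Each edge of `Q` has its outer end outside some member; intersecting these finitely many
    -- members gives one whose boundary contains all of `Q`.
    have hex : ∃ X ∈ 𝓧, (Q : Set (Sym2 V)) ⊆ cut G X := by
      induction Q using Finset.induction_on with
      | empty => exact ⟨hne.some, hne.some_mem, by simp⟩
      | insert e Q he ih =>
        rw [Finset.coe_insert, Set.insert_subset_iff] at hQ
        obtain ⟨X, hX, hQX⟩ := ih hQ.2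
        obtain ⟨u, hu, v, hv, huv, rfl⟩ := hQ.1
        obtain ⟨Y, hY, hvY⟩ : ∃ Y ∈ 𝓧, v ∉ Y := by
          by_contra hcon
          push Not at hcon
          exact hv hcon
        refine ⟨X ∩ Y, hinter X hX Y hY, ?_⟩
        rw [Finset.coe_insert, Set.insert_subset_iff]
        refine ⟨mem_cut huv ⟨hu X hX, hu Y hY⟩ fun h => hvY h.2, fun f hf => ?_⟩
        obtain ⟨a, ha, b, hb, hab, hfab⟩ := hQ.2 hf
        obtain ⟨a', ha', b', hb', hab', rfl⟩ := hQX hf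
        rcases Sym2.eq_iff.1 hfab with ⟨rfl, rfl⟩ | ⟨rfl, rfl⟩
        · exact mem_cut hab' ⟨ha', ha Y hY⟩ fun h => hb' h.1
        · exact absurd (ha X hX) hb'
    obtain ⟨X, hX, hQX⟩ := hex
    refine le_trans ?_ (hm X hX)
    rw [← Set.ncard_coe_finset]
    exact Set.ncard_le_ncard hQX (hfin X hX)
  have hfin' : (cut G (⋂₀ 𝓧)).Finite := by
    by_contra hinf
    obtain ⟨Q, hQ, hQk⟩ := Set.Infinite.exists_subset_card_eq hinf (m + 1)
    exact absurd (hcard Q hQ) (by omega)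
  refine ⟨hfin', ?_⟩
  rw [Set.ncard_eq_toFinset_card _ hfin']
  exact hcard _ (by simp)

/-- Finitely many of the ends in `A` force all cuts to be as large as `A` does. -/
theorem exists_finite_ends {G : SimpleGraph V} {S : Set V} {A : Set (EdgeEnd G)} {X₀ : Set V}
    (hX₀ : EndCut G S A X₀) {k : ℕ} (hk : ∀ X, EndCut G S A X → k ≤ (cut G X).ncard) :
    ∃ B ⊆ A, B.Finite ∧ ∀ X, EndCut G S B X → k ≤ (cut G X).ncard := by
  let N : Set (EdgeEnd G) → Set ℕ := fun B => {n | ∃ X, EndCut G S B X ∧ (cut G X).ncard = n}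
  have hN : ∀ B ⊆ A, (N B).Nonempty := fun B hB => ⟨_, X₀, hX₀.mono hB, rfl⟩
  have hle : ∀ B X, EndCut G S B X → sInf (N B) ≤ (cut G X).ncard :=
    fun B X h => Nat.sInf_le ⟨X, h, rfl⟩
  let M : Set ℕ := {n | ∃ B ⊆ A, B.Finite ∧ sInf (N B) = n}
  have hMne : M.Nonempty := ⟨_, ∅, Set.empty_subset _, Set.finite_empty, rfl⟩
  have hMb : BddAbove M := by
    refine ⟨(cut G X₀).ncard, ?_⟩
    rintro _ ⟨B, hB, -, rfl⟩
    exact hle B X₀ (hX₀.mono hB)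
  -- `B` maximises the minimum cut size over finite subsets of `A`; the cut `X₀` bounds these sizes.
  obtain ⟨B, hBA, hBfin, hB⟩ := Nat.sSup_mem hMne hMb
  refine ⟨B, hBA, hBfin, ?_⟩
  let 𝓧 : Set (Set V) := {X | EndCut G S B X ∧ (cut G X).ncard = sInf (N B)}
  have hinter : ∀ X ∈ 𝓧, ∀ Y ∈ 𝓧, X ∩ Y ∈ 𝓧 := by
    rintro X ⟨hX, hX'⟩ Y ⟨hY, hY'⟩
    refine ⟨hX.inter hY, ?_⟩
    have h1 := ncard_cut_inter_add_ncard_cut_union_le hX.finite hY.finite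
    have h2 := hle B _ (hX.inter hY)
    have h3 := hle B _ (hX.union hY)
    -- Intersection and union are both cuts for `B`, so neither boundary is below the minimum;
    -- submodularity then makes both equal to it.
    omega
  have hne : 𝓧.Nonempty := by
    obtain ⟨X, hX, hX'⟩ := Nat.sInf_mem (hN B hBA)
    exact ⟨X, hX, hX'⟩
  obtain ⟨hfin, hcard⟩ := ncard_cut_sInter_le hne hinter (fun X hX => hX.1.finite)
    (fun X hX => hX.2.le)
  have hlim : EndCut G S A (⋂₀ 𝓧) := by
    refine ⟨Set.subset_sInter fun X hX => hX.1.subset, hfin, fun r hr => ?_⟩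
    have hins : insert r.edgeEnd B ⊆ A := Set.insert_subset hr hBA
    -- A minimum cut for `B` together with the end of `r` is no larger than one for `B`, by
    -- maximality. It is therefore a member of `𝓧`, and it excludes a tail of `r`.
    obtain ⟨X, hX, hX'⟩ := Nat.sInf_mem (hN _ hins)
    have h1 : sInf (N (insert r.edgeEnd B)) ≤ sInf (N B) := by
      rw [hB]
      exact le_csSup hMb ⟨_, hins, hBfin.insert _, rfl⟩
    have h2 := hX.mono (Set.subset_insert r.edgeEnd B)
    have hX𝓧 : X ∈ 𝓧 := ⟨h2, le_antisymm (hX'.trans_le h1) (hle B X h2)⟩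
    exact (hX.eventually r (Set.mem_insert _ _)).mono fun i hi h => hi (h X hX𝓧)
  intro X hX
  exact (hk _ hlim).trans (hcard.trans (hle B X hX))

/-! ### Tight neighbourhoods of an undominated end -/

/-- `Y` is connected, has finite boundary, and contains a tail of `r`. -/
structure Nbhd {G : SimpleGraph V} (r : Ray G) (Y : Set V) : Prop where
  finite : (cut G Y).Finite
  eventually : ∀ᶠ i in Filter.atTop, r.vert i ∈ Y
  connected : ∀ u ∈ Y, ∀ v ∈ Y, ∃ p : G.Walk u v, ∀ z ∈ p.support, z ∈ Y

/-- No neighbourhood of the end contained in `Y` has a smaller boundary than `Y`. -/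
def Tight {G : SimpleGraph V} (r : Ray G) (Y : Set V) : Prop :=
  ∀ Y' ⊆ Y, Nbhd r Y' → (cut G Y).ncard ≤ (cut G Y').ncard

theorem Ray.nbhd_comp {G : SimpleGraph V} (r : Ray G) {Z : Set (Sym2 V)} (hZ : Z.Finite) :
    Nbhd r (r.comp Z) := by
  refine ⟨hZ.subset (r.cut_comp_subset Z), r.eventually_mem_comp hZ, fun u hu v hv => ?_⟩
  obtain ⟨p⟩ := r.reachable_of_mem_comp hu hv
  classical
  refine ⟨p.mapLe (G.deleteEdges_le Z), fun z hz => ?_⟩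
  rw [SimpleGraph.Walk.support_mapLe_eq_support] at hz
  exact r.mem_comp_of_reachable hu ⟨p.takeUntil z hz⟩

theorem Nbhd.comp_subset {G : SimpleGraph V} {r : Ray G} {Y : Set V} (hY : Nbhd r Y)
    {Z : Set (Sym2 V)} (hZ : cut G Y ⊆ Z) : r.comp Z ⊆ Y := by
  intro v hv
  obtain ⟨i, h1, h2⟩ := (Filter.Eventually.and hv hY.eventually).exists
  exact mem_of_reachable hZ h2 h1.symm

/-- Since no vertex dominates the end, finitely many edges cut all of `B` off from it. A
neighbourhood of minimum boundary among those in `Y₀` avoiding `B` is tight, because any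
neighbourhood inside it also competes. -/
theorem exists_tight {G : SimpleGraph V} {r : Ray G}
    (hr : ∀ v, ¬ EdgeDominates G v r.edgeEnd) {Y₀ : Set V} (hY₀ : Nbhd r Y₀) {B : Set V}
    (hB : B.Finite) : ∃ Y ⊆ Y₀, Disjoint Y B ∧ Nbhd r Y ∧ Tight r Y := by
  choose Z hZfin hZ using fun v => exists_notMem_comp (hr v)
  let D : Set (Sym2 V) := cut G Y₀ ∪ ⋃ b ∈ B, Z b
  have hD : D.Finite := hY₀.finite.union (hB.biUnion fun b _ => hZfin b)
  let M : Set ℕ := {n | ∃ Y ⊆ Y₀, Disjoint Y B ∧ Nbhd r Y ∧ (cut G Y).ncard = n}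
  have hM : M.Nonempty := by
    refine ⟨_, r.comp D, hY₀.comp_subset Set.subset_union_left, ?_, r.nbhd_comp hD, rfl⟩
    rw [Set.disjoint_left]
    intro b hb hbB
    exact hZ b (r.comp_anti ((Set.subset_biUnion_of_mem (u := Z) hbB).trans
      Set.subset_union_right) hb)
  obtain ⟨Y, hYY₀, hYB, hY, hmin⟩ := Nat.sInf_mem hM
  refine ⟨Y, hYY₀, hYB, hY, fun Y' hY' hn => ?_⟩
  rw [hmin]
  exact Nat.sInf_le ⟨Y', hY'.trans hYY₀, hYB.mono_left hY', hn, rfl⟩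

/-- The boundary edges of `Y`, directed into `Y`. -/
def bdry (G : SimpleGraph V) (Y : Set V) : Set (V × V) :=
  {d | d.1 ∉ Y ∧ d.2 ∈ Y ∧ G.Adj d.1 d.2}

theorem mk_mem_cut_of_mem_bdry {G : SimpleGraph V} {Y : Set V} {d : V × V} (hd : d ∈ bdry G Y) :
    s(d.1, d.2) ∈ cut G Y :=
  ⟨d.2, hd.2.1, d.1, hd.1, hd.2.2.symm, Sym2.eq_swap⟩

theorem bdry_ext {G : SimpleGraph V} {Y : Set V} {d d' : V × V} (hd : d ∈ bdry G Y)
    (hd' : d' ∈ bdry G Y) (h : s(d.1, d.2) = s(d'.1, d'.2)) : d = d' := by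
  rcases Sym2.eq_iff.1 h with ⟨h1, h2⟩ | ⟨h1, h2⟩
  · exact Prod.ext h1 h2
  · exact absurd hd'.2.1 (h1 ▸ hd.1)

/-- A walk from outside `Y` into `Y' ⊆ Y` contains a walk that starts just inside `Y`, stays in
`Y \ Y'`, and ends just inside `Y'`. -/
theorem exists_crossing_walk {G : SimpleGraph V} {Y Y' : Set V} (hsub : Y' ⊆ Y)
    (hends : ∀ e ∈ cut G Y, ∀ v ∈ e, v ∉ Y') {a b : V} (p : G.Walk a b) (ha : a ∉ Y)
    (hb : b ∈ Y') :
    ∃ d ∈ bdry G Y, ∃ d' ∈ bdry G Y', ∃ q : G.Walk d.2 d'.2, s(d.1, d.2) ∈ p.edges ∧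
      s(d'.1, d'.2) ∈ q.edges ∧ (∀ z ∈ q.support, z ∈ Y) ∧ (∀ e ∈ q.edges, ∃ z ∈ e, z ∉ Y') ∧
      q.edges ⊆ p.edges := by
  obtain ⟨x, y, q, hx, hy, hxy, hxyp, hq, hqp⟩ := exists_first_hit p (fun h => ha (hsub h)) hb
  have hxY : x ∈ Y := by
    -- Otherwise `xy` would be a boundary edge of `Y` with its end `y` in `Y'`.
    by_contra h
    exact hends s(y, x) (mem_cut hxy.symm (hsub hy) h) y (by simp) hy
  -- Following `q` backwards from `x` to the first exit from `Y` finds its last entry into `Y`.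
  obtain ⟨u, v, q', hu, hv, huv, huvq, hq', hqq⟩ :=
    exists_first_hit (T := Yᶜ) q.reverse (fun h => h hxY) ha
  rw [SimpleGraph.Walk.edges_reverse, List.mem_reverse] at huvq
  rw [SimpleGraph.Walk.edges_reverse] at hqq
  have hsupp : ∀ z ∈ q'.support, z ∈ Y := fun z hz => not_not.1 (hq' z hz)
  have hedges : ∀ e ∈ q'.edges, e ∈ q.edges := fun e he => List.mem_reverse.1 (hqq he)
  refine ⟨(v, u), ⟨hv, not_not.1 hu, huv.symm⟩, (x, y), ⟨hx, hy, hxy⟩,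
    q'.reverse.concat hxy, ?_, ?_, ?_, ?_, ?_⟩
  · rw [Sym2.eq_swap]; exact hqp huvq
  · simp [SimpleGraph.Walk.edges_concat]
  · intro z hz
    rw [SimpleGraph.Walk.support_concat, List.mem_append,
      SimpleGraph.Walk.support_reverse, List.mem_reverse, List.mem_singleton] at hz
    rcases hz with hz | rfl
    · exact hsupp z hz
    · exact hsub hy
  · intro e he
    rw [SimpleGraph.Walk.edges_concat, List.concat_eq_append, List.mem_append,
      SimpleGraph.Walk.edges_reverse, List.mem_reverse, List.mem_singleton] at he
    rcases he with he | rfl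
    · induction e with
      | _ s t => exact ⟨s, by simp, hq s (q.fst_mem_support_of_mem_edges (hedges _ he))⟩
    · exact ⟨x, by simp, hx⟩
  · intro e he
    rw [SimpleGraph.Walk.edges_concat, List.concat_eq_append, List.mem_append,
      SimpleGraph.Walk.edges_reverse, List.mem_reverse, List.mem_singleton] at he
    rcases he with he | rfl
    · exact hqp (hedges e he)
    · exact hxyp

/-- All boundary edges of a tight neighbourhood can be linked disjointly to boundary edges of a
smaller neighbourhood. -/
theorem exists_linkage {G : SimpleGraph V} {r : Ray G} {Y Y' : Set V} (hY : Nbhd r Y)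
    (ht : Tight r Y) (hY' : Nbhd r Y') (hsub : Y' ⊆ Y)
    (hends : ∀ e ∈ cut G Y, ∀ v ∈ e, v ∉ Y') :
    ∃ (σ : bdry G Y → bdry G Y') (Q : ∀ d, G.Walk d.1.2 (σ d).1.2),
      (∀ d, 0 < (Q d).length) ∧ (∀ d, ∀ z ∈ (Q d).support, z ∈ Y) ∧
      (∀ d, ∀ e ∈ (Q d).edges, ∃ z ∈ e, z ∉ Y') ∧
      (∀ d d', d ≠ d' → ∀ e ∈ (Q d).edges, e ∉ (Q d').edges) ∧ Function.Injective σ := by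
  obtain ⟨s, t, p, hs, ht', hp⟩ := exists_disjoint_walks G (S := Yᶜ) (T := Y')
    (Set.disjoint_left.2 fun v hv hv' => hv (hsub hv')) (cut G Y).ncard <| by
      intro Z hZ hsep
      -- After deleting a separator `Z`, the component of the end lies inside `Y`, so tightness
      -- bounds `|cut G Y|` by the size of its boundary, which is contained in `Z`.
      refine (ht (r.comp Z) ?_ (r.nbhd_comp hZ)).trans
        (Set.ncard_le_ncard (r.cut_comp_subset Z) hZ)
      intro v hv
      by_contra hvY
      obtain ⟨i, h1, h2⟩ := (Filter.Eventually.and hv hY'.eventually).exists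
      exact hsep v hvY _ h2 h1
  choose d hd d' hd' q hdp hdq hqY hqY' hqp using fun i =>
    exists_crossing_walk hsub hends (p i) (hs i) (ht' i)
  -- There are as many walks as boundary edges of `Y`, and they enter through distinct ones, so
  -- every boundary edge is used.
  have hsurj : ∀ c : bdry G Y, ∃ i, d i = c.1 := by
    intro c
    have hinj : Function.Injective fun i => s((d i).1, (d i).2) := by
      intro i j hij
      by_contra hne
      exact hp hne _ (hdp i) (by simp only at hij; rw [hij]; exact hdp j)
    have hrange : Set.range (fun i => s((d i).1, (d i).2)) = cut G Y := by
      refine Set.eq_of_subset_of_ncard_le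
        (Set.range_subset_iff.2 fun i => mk_mem_cut_of_mem_bdry (hd i)) ?_ hY.finite
      rw [← Set.image_univ, Set.ncard_image_of_injective _ hinj, Set.ncard_univ,
        Nat.card_eq_fintype_card, Fintype.card_fin]
    have hc := mk_mem_cut_of_mem_bdry c.2
    rw [← hrange] at hc
    obtain ⟨i, hi⟩ := hc
    exact ⟨i, bdry_ext (hd i) c.2 hi⟩
  choose ind hind using hsurj
  have hindinj : ∀ c c', c ≠ c' → ind c ≠ ind c' := by
    intro c c' hne h
    exact hne (Subtype.ext (by rw [← hind c, ← hind c', h]))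
  let σ : bdry G Y → bdry G Y' := fun c => ⟨d' (ind c), hd' _⟩
  let Q : ∀ c : bdry G Y, G.Walk c.1.2 (σ c).1.2 := fun c =>
    (q (ind c)).copy (congrArg Prod.snd (hind c)) rfl
  have hQe : ∀ c, (Q c).edges = (q (ind c)).edges := fun c => SimpleGraph.Walk.edges_copy _ _ _
  have hQs : ∀ c, (Q c).support = (q (ind c)).support :=
    fun c => SimpleGraph.Walk.support_copy _ _ _
  have hmem : ∀ c, s((σ c).1.1, (σ c).1.2) ∈ (Q c).edges := fun c => by
    rw [hQe]; exact hdq _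
  have hdisj : ∀ c c', c ≠ c' → ∀ e ∈ (Q c).edges, e ∉ (Q c').edges := by
    intro c c' hne e he he'
    rw [hQe] at he he'
    exact hp (hindinj c c' hne) e (hqp _ he) (hqp _ he')
  refine ⟨σ, Q, fun c => ?_, fun c z hz => ?_, fun c e he => ?_, hdisj, fun c c' h => ?_⟩
  · rw [← SimpleGraph.Walk.length_edges]
    exact List.length_pos_of_mem (hmem c)
  · rw [hQs] at hz
    exact hqY _ z hz
  · rw [hQe] at he
    exact hqY' _ e he
  · by_contra hne
    have heq : s((σ c).1.1, (σ c).1.2) = s((σ c').1.1, (σ c').1.2) := by rw [h]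
    exact hdisj c c' hne _ (hmem c) (by rw [heq]; exact hmem c')

/-- A decreasing sequence of tight neighbourhoods whose boundaries have no common endpoints. -/
theorem exists_tight_sequence {G : SimpleGraph V} {r : Ray G}
    (hr : ∀ v, ¬ EdgeDominates G v r.edgeEnd) {Z : Set (Sym2 V)} (hZ : Z.Finite) :
    ∃ Y : ℕ → Set V, Y 0 ⊆ r.comp Z ∧ (∀ n, Nbhd r (Y n)) ∧ (∀ n, Tight r (Y n)) ∧
      (∀ n, Y (n + 1) ⊆ Y n) ∧ ∀ n, ∀ e ∈ cut G (Y n), ∀ v ∈ e, v ∉ Y (n + 1) := by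
  obtain ⟨Y₀, hY₀, -, hn, ht⟩ := exists_tight hr (r.nbhd_comp hZ) Set.finite_empty
  have hstep : ∀ Y : {Y : Set V // Nbhd r Y ∧ Tight r Y}, ∃ Y' : {Y : Set V // Nbhd r Y ∧ Tight r Y},
      Y'.1 ⊆ Y.1 ∧ ∀ e ∈ cut G Y.1, ∀ v ∈ e, v ∉ Y'.1 := by
    rintro ⟨Y, hY, -⟩
    have hfin : (⋃ e ∈ cut G Y, {v | v ∈ e}).Finite := by
      refine hY.finite.biUnion fun e _ => ?_
      induction e with
      | _ a b => exact (Set.toFinite {a, b}).subset fun v hv => by simpa using hv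
    obtain ⟨Y', hsub, hdisj, hn', ht'⟩ := exists_tight hr hY hfin
    exact ⟨⟨Y', hn', ht'⟩, hsub, fun e he v hv hvY =>
      Set.disjoint_left.1 hdisj hvY (Set.mem_biUnion he hv)⟩
  choose f hf1 hf2 using hstep
  let Y : ℕ → {Y : Set V // Nbhd r Y ∧ Tight r Y} := fun n =>
    Nat.rec ⟨Y₀, hn, ht⟩ (fun _ Y => f Y) n
  exact ⟨fun n => (Y n).1, hY₀, fun n => (Y n).2.1, fun n => (Y n).2.2, fun n => hf1 (Y n),
    fun n => hf2 (Y n)⟩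

/-- A neighbour of a vertex common to all `Y n` is again common to all: an edge leaving `Y n` would
have no end in `Y (n + 1)`. Connectedness of `G`, used only here, would then put `a` in `Y 0`. -/
theorem iInter_eq_empty_of_cut_disjoint {G : SimpleGraph V} (hG : G.Connected) {Y : ℕ → Set V}
    (hends : ∀ n, ∀ e ∈ cut G (Y n), ∀ v ∈ e, v ∉ Y (n + 1)) {a : V} (ha : a ∉ Y 0) (z : V) :
    ∃ n, z ∉ Y n := by
  by_contra hcon
  push Not at hcon
  have h := (SimpleGraph.reachable_iff_reflTransGen _ _).1 (hG.preconnected z a)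
  have key : ∀ v, Relation.ReflTransGen G.Adj z v → ∀ n, v ∈ Y n := by
    intro v hv
    induction hv with
    | refl => exact hcon
    | @tail v w _ hvw ih =>
      intro n
      by_contra hw
      exact hends n _ (mem_cut hvw (ih n) hw) v (by simp) (ih (n + 1))
  exact ha (key a h 0)

/-- A ray that eventually lies in each of the neighbourhoods belongs to the end. -/
theorem edgeEnd_eq_of_eventually {G : SimpleGraph V} {r s : Ray G} {Y : ℕ → Set V}
    (hanti : Antitone Y) (hY : ∀ n, Nbhd r (Y n)) (hempty : ∀ z, ∃ n, z ∉ Y n)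
    (hs : ∀ n, ∀ᶠ i in Filter.atTop, s.vert i ∈ Y n) : r.edgeEnd = s.edgeEnd := by
  refine (r.edgeEnd_eq_iff s).2 fun Z hZ _ => ?_
  -- Once `Y n` contains no endpoint of an edge of `Z`, the connected set `Y n` survives the
  -- deletion of `Z` within one component.
  have hex : ∃ n, ∀ e ∈ Z, ∀ v ∈ e, v ∉ Y n := by
    have h : ∀ e ∈ Z, ∀ᶠ n in Filter.atTop, ∀ v ∈ e, v ∉ Y n := by
      have h1 : ∀ v, ∀ᶠ n in Filter.atTop, v ∉ Y n := fun v => by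
        obtain ⟨n, hn⟩ := hempty v
        exact (Filter.eventually_ge_atTop n).mono fun m hm hv => hn (hanti hm hv)
      intro e _
      induction e with
      | _ a b =>
        filter_upwards [h1 a, h1 b] with n ha hb v hv
        rcases Sym2.mem_iff.1 hv with rfl | rfl
        · exact ha
        · exact hb
    exact ((Filter.eventually_all_finite hZ).2 h).exists
  obtain ⟨n, hn⟩ := hex
  obtain ⟨i, h1, h2⟩ := ((r.eventually_mem_comp hZ).and (hY n).eventually).exists
  filter_upwards [hs n] with j hj
  obtain ⟨p, hp⟩ := (hY n).connected _ h2 _ hj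
  refine r.mem_comp_of_reachable h1 ⟨p.toDeleteEdges Z fun e he heZ => ?_⟩
  induction e with
  | _ a b => exact hn _ heZ a (by simp) (hp a (p.fst_mem_support_of_mem_edges he))

/-- An undominated end has arbitrarily small neighbourhoods all of whose boundary edges extend to
edge-disjoint rays of the end inside the neighbourhood. -/
theorem exists_ray_system {G : SimpleGraph V} (hG : G.Connected) {r : Ray G}
    (hr : ∀ v, ¬ EdgeDominates G v r.edgeEnd) {Z : Set (Sym2 V)} (hZ : Z.Finite) :
    ∃ Y ⊆ r.comp Z, (∀ᶠ i in Filter.atTop, r.vert i ∈ Y) ∧ ∃ R : bdry G Y → Ray G,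
      (∀ d, (R d).vert 0 = d.1.2) ∧ (∀ d, (R d).edgeEnd = r.edgeEnd) ∧
      (∀ d i, (R d).vert i ∈ Y) ∧ ∀ d d', d ≠ d' → Disjoint (R d).edges (R d').edges := by
  obtain ⟨Y, hY₀, hn, ht, hsub, hends⟩ := exists_tight_sequence hr hZ
  have hanti : Antitone Y := antitone_nat_of_succ_le hsub
  refine ⟨Y 0, hY₀, (hn 0).eventually, ?_⟩
  choose σ Q hQ0 hQY hQY' hQd hσ using fun n =>
    exists_linkage (hn n) (ht n) (hn (n + 1)) (hsub n) (hends n)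
  -- `D d n` is the boundary edge of `Y n` reached from `d` by following the linkages.
  let D : bdry G (Y 0) → ∀ n, bdry G (Y n) := fun d n => Nat.rec d (fun n c => σ n c) n
  have hD : ∀ n d d', d ≠ d' → D d n ≠ D d' n := by
    intro n d d' hne
    induction n with
    | zero => exact hne
    | succ n ih => exact fun h => ih (hσ n h)
  have hQdisj : ∀ d d', d ≠ d' → ∀ m n, ∀ e ∈ (Q m (D d m)).edges, e ∉ (Q n (D d' n)).edges := by
    -- Each edge at level `m` has an end outside `Y (m + 1)`, whereas walks at later levels stay
    -- inside `Y (m + 1)`.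
    have hlt : ∀ d d' m n, m < n → ∀ e ∈ (Q m (D d m)).edges, e ∉ (Q n (D d' n)).edges := by
      intro d d' m n hmn e he he'
      obtain ⟨z, hz, hzY⟩ := hQY' m _ e he
      refine hzY (hanti (Nat.succ_le_of_lt hmn) (hQY n (D d' n) z ?_))
      obtain ⟨z', rfl⟩ := hz
      exact SimpleGraph.Walk.fst_mem_support_of_mem_edges _ he'
    intro d d' hne m n e he he'
    rcases lt_trichotomy m n with h | rfl | h
    · exact hlt _ _ _ _ h e he he'
    · exact hQd m _ _ (hD m d d' hne) e he he'
    · exact hlt _ _ _ _ h e he' he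
  have hray : ∀ d : bdry G (Y 0), ∃ s : Ray G, s.vert 0 = d.1.2 ∧ s.edgeEnd = r.edgeEnd ∧
      (∀ i, s.vert i ∈ Y 0) ∧ ∀ e ∈ s.edges, ∃ n, e ∈ (Q n (D d n)).edges := by
    intro d
    have hempty := iInter_eq_empty_of_cut_disjoint hG hends d.2.1
    obtain ⟨w, hw0, hwadj, hwedge, hwev⟩ := exists_infinite_concat (fun n => (D d n).1.2)
      (fun n => Q n (D d n)) (fun n => hQ0 n _)
    have hwY : ∀ n, ∀ᶠ i in Filter.atTop, w i ∈ Y n := fun n =>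
      (hwev n).mono fun i ⟨m, hnm, hm⟩ => hanti hnm (hQY m _ _ hm)
    -- The walk eventually lies in each `Y n`, and `v` is missing from one of them; loop erasure
    -- therefore applies.
    have hfin : ∀ v, {i | w i = v}.Finite := by
      intro v
      obtain ⟨n, hv⟩ := hempty v
      obtain ⟨N, hN⟩ := Filter.eventually_atTop.1 (hwY n)
      refine (Set.finite_lt_nat N).subset fun i hi => ?_
      by_contra hlt
      exact hv (hi ▸ hN i (not_lt.1 hlt))
    obtain ⟨s, φ, hφ, hsφ, hs0, hsedge⟩ := exists_ray_of_infinite_walk w hwadj hfin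
    have hwY0 : ∀ i, w i ∈ Y 0 := by
      intro i
      obtain ⟨n, hn⟩ := hwedge i
      exact hanti (Nat.zero_le n) (hQY n _ _ (SimpleGraph.Walk.fst_mem_support_of_mem_edges _ hn))
    refine ⟨s, hs0.trans hw0, (edgeEnd_eq_of_eventually hanti hn hempty fun n => ?_).symm,
      fun i => hsφ i ▸ hwY0 _, fun e he => ?_⟩
    · filter_upwards [hφ.eventually (hwY n)] with i hi
      rwa [hsφ]
    · obtain ⟨i, rfl⟩ := hsedge e he
      exact hwedge i
  choose R hR0 hRend hRY hRe using hray
  refine ⟨R, hR0, hRend, hRY, fun d d' hne => Set.disjoint_left.2 fun e he he' => ?_⟩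
  obtain ⟨m, hm⟩ := hRe d e he
  obtain ⟨n, hn⟩ := hRe d' e he'
  exact hQdisj d d' hne m n e hm hn

/-! ### Assembling the paths -/

/-- Every end `ω ∈ A` has, inside any of its components, a target set `T` that is not separated
from `ω` by finitely many edges and such that walks entering `T` through distinct edges extend
disjointly to `S`–`A` paths. -/
theorem exists_target {G : SimpleGraph V} (hG : G.Connected) (S : Set V) {A : Set (EdgeEnd G)}
    {r : Ray G} (hr : r.edgeEnd ∈ A) {Z : Set (Sym2 V)} (hZ : Z.Finite) :
    ∃ T ⊆ r.comp Z, (∀ Z' : Set (Sym2 V), Z'.Finite → ∃ t ∈ T, t ∈ r.comp Z') ∧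
      ∃ E : V × V → Set (Sym2 V), (∀ d, ∀ e ∈ E d, ∀ z ∈ e, z ∈ T) ∧
        (∀ d d', d ≠ d' → Disjoint (E d) (E d')) ∧
        ∀ d ∈ bdry G T, ∀ u ∈ S, ∀ p : G.Walk u d.2, ∃ P : VertexEndPath G S A,
          ∀ e ∈ P.edges, e ∈ p.edges ∨ e ∈ E d := by
  by_cases hdom : ∃ v, EdgeDominates G v r.edgeEnd
  · obtain ⟨v, hv⟩ := hdom
    -- A walk reaching a dominating vertex is already complete, so the extensions are empty.
    refine ⟨{v}, Set.singleton_subset_iff.2 (hv.mem_comp hZ),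
      fun Z' hZ' => ⟨v, rfl, hv.mem_comp hZ'⟩, fun _ => ∅, fun _ _ h => absurd h (Set.notMem_empty _),
      fun _ _ _ => Set.disjoint_empty _, ?_⟩
    rintro ⟨x, y⟩ ⟨-, hy, -⟩ u hu p
    obtain rfl : y = v := hy
    classical
    exact ⟨.finite p.bypass p.bypass_isPath hu ⟨_, hr, hv⟩,
      fun e he => Or.inl (p.edges_bypass_subset_edges he)⟩
  · push Not at hdom
    obtain ⟨Y, hYZ, hev, R, hR0, hRend, hRY, hRd⟩ := exists_ray_system hG hdom hZ
    refine ⟨Y, hYZ, fun Z' hZ' => ?_, fun d => {e | ∃ h : d ∈ bdry G Y, e ∈ (R ⟨d, h⟩).edges},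
      ?_, ?_, ?_⟩
    · obtain ⟨i, h1, h2⟩ := (hev.and (r.eventually_mem_comp hZ')).exists
      exact ⟨_, h1, h2⟩
    · rintro d e ⟨h, i, rfl⟩ z hz
      rcases Sym2.mem_iff.1 hz with rfl | rfl
      · exact hRY _ _
      · exact hRY _ _
    · intro d d' hne
      rw [Set.disjoint_left]
      rintro e ⟨h, he⟩ ⟨h', he'⟩
      exact Set.disjoint_left.1 (hRd _ _ fun h => hne (congrArg Subtype.val h)) he he'
    · intro d hd u hu p
      obtain ⟨r', h0, hend, hedges⟩ := Ray.exists_prepend p (R ⟨d, hd⟩) (hR0 _)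
      exact ⟨.ray r' (h0 ▸ hu) (by rw [hend, hRend]; exact hr),
        fun e he => (hedges e he).imp_right fun h => ⟨hd, h⟩⟩

/-- Finitely many ends live in disjoint components after deleting some finite set of edges, which
may be chosen to contain a given one. -/
theorem exists_finite_separating {G : SimpleGraph V} {B : Set (EdgeEnd G)} (hB : B.Finite)
    (ρ : EdgeEnd G → Ray G) (hρ : ∀ ω, (ρ ω).edgeEnd = ω) {Z₀ : Set (Sym2 V)} (hZ₀ : Z₀.Finite) :
    ∃ Z : Set (Sym2 V), Z.Finite ∧ Z₀ ⊆ Z ∧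
      ∀ ω ∈ B, ∀ ω' ∈ B, ω ≠ ω' → Disjoint ((ρ ω).comp Z) ((ρ ω').comp Z) := by
  have h : ∀ ω ω' : EdgeEnd G, ∃ W : Set (Sym2 V), W.Finite ∧ (ω ≠ ω' → ∀ Z', W ⊆ Z' →
      Disjoint ((ρ ω).comp Z') ((ρ ω').comp Z')) := by
    intro ω ω'
    by_cases hne : ω = ω'
    · exact ⟨∅, Set.finite_empty, fun h => absurd hne h⟩
    · obtain ⟨W, hW, h⟩ := exists_disjoint_comp (r := ρ ω) (s := ρ ω') (by rwa [hρ, hρ])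
      exact ⟨W, hW, fun _ => h⟩
  choose W hW hWd using h
  refine ⟨Z₀ ∪ ⋃ ω ∈ B, ⋃ ω' ∈ B, W ω ω',
    hZ₀.union (hB.biUnion fun ω _ => hB.biUnion fun ω' _ => hW ω ω'), Set.subset_union_left,
    fun ω hω ω' hω' hne => hWd ω ω' hne _ ?_⟩
  exact fun e he => Or.inr (Set.mem_biUnion hω (Set.mem_biUnion hω' he))

/-- Finiteness of `B` allows one finite `Z` to separate its ends from each other and from `S`, so
targets and extensions for different ends are disjoint, and all targets miss `S`. -/
theorem exists_disjoint_paths_of_finite {G : SimpleGraph V} (hG : G.Connected) {S : Set V}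
    {A B : Set (EdgeEnd G)} (hBA : B ⊆ A) (hB : B.Finite) {X₀ : Set V} (hX₀ : EndCut G S B X₀)
    {k : ℕ} (hk : ∀ X, EndCut G S B X → k ≤ (cut G X).ncard) :
    ∃ P : Fin k → VertexEndPath G S A, Pairwise fun i j => Disjoint (P i).edges (P j).edges := by
  obtain ⟨ρ, hρ⟩ : ∃ ρ : EdgeEnd G → Ray G, ∀ ω, (ρ ω).edgeEnd = ω :=
    ⟨Quotient.out, Quotient.out_eq⟩
  obtain ⟨Z, hZ, hZX, hZd⟩ := exists_finite_separating hB ρ hρ hX₀.finite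
  have hex : ∀ ω : B, _ := fun ω =>
    exists_target hG S (r := ρ ω) (by rw [hρ]; exact hBA ω.2) hZ
  choose T hTZ hTcomp E hET hEd hpath using hex
  let TT : Set V := ⋃ ω, T ω
  have hST : Disjoint S TT := by
    rw [Set.disjoint_left]
    intro v hvS hvT
    obtain ⟨ω, hω⟩ := Set.mem_iUnion.1 hvT
    obtain ⟨i, h1, h2⟩ := (Filter.Eventually.and (hTZ ω hω)
      (hX₀.eventually (ρ ω) (by rw [hρ]; exact ω.2))).exists
    exact h2 (mem_of_reachable hZX (hX₀.subset hvS) h1)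
  obtain ⟨s, t, p, hs, ht, hp⟩ := exists_disjoint_walks G hST k <| by
    intro Z' hZ' hsep
    -- If `Z'` separates `S` from the targets, its reachable set is a cut for `B`: a target vertex
    -- lies in the component of its end after deleting `Z'`, so a tail in the reachable set would
    -- make that target vertex reachable.
    have hcut := hZ'.subset (cut_reach_subset G Z' S)
    refine (hk (reach G Z' S) ⟨subset_reach _ _ _, hcut, fun r hr => ?_⟩).trans
      (Set.ncard_le_ncard (cut_reach_subset G Z' S) hZ')
    refine (r.eventually_mem_or hcut).resolve_left fun hev => ?_
    obtain ⟨y, hyT, hy⟩ := hTcomp ⟨_, hr⟩ Z' hZ'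
    obtain ⟨i, h1, s, hs, h2⟩ := (Filter.Eventually.and hy
      (Ray.eventually_mem_congr (hρ r.edgeEnd).symm hcut hev)).exists
    exact hsep s hs y (Set.mem_iUnion.2 ⟨_, hyT⟩) (h2.trans h1.symm)
  choose x y q hx hy hxy hxyp hqT hqp using fun i =>
    exists_first_hit (p i) (Set.disjoint_left.1 hST (hs i)) (ht i)
  choose ω hω using fun i => Set.mem_iUnion.1 (hy i)
  have hbd : ∀ i, (x i, y i) ∈ bdry G (T (ω i)) := fun i =>
    ⟨fun h => hx i (Set.mem_iUnion.2 ⟨_, h⟩), hω i, hxy i⟩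
  choose P hP using fun i => hpath (ω i) (x i, y i) (hbd i) (s i) (hs i) ((q i).concat (hxy i))
  -- edges before the target set
  have hpre : ∀ i, ∀ e ∈ ((q i).concat (hxy i)).edges, e ∈ (p i).edges ∧ ∃ z ∈ e, z ∉ TT := by
    intro i e he
    rw [SimpleGraph.Walk.edges_concat, List.concat_eq_append, List.mem_append,
      List.mem_singleton] at he
    rcases he with he | rfl
    · refine ⟨hqp i he, ?_⟩
      induction e with
      | _ a b => exact ⟨a, by simp, hqT i a ((q i).fst_mem_support_of_mem_edges he)⟩
    · exact ⟨hxyp i, x i, by simp, hx i⟩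
  have hpost : ∀ i j, ∀ e ∈ ((q i).concat (hxy i)).edges, e ∉ E (ω j) (x j, y j) := by
    intro i j e he he'
    obtain ⟨-, z, hz, hzT⟩ := hpre i e he
    exact hzT (Set.mem_iUnion.2 ⟨_, hET _ _ e he' z hz⟩)
  refine ⟨P, fun i j hij => Set.disjoint_left.2 fun e he he' => ?_⟩
  rcases hP i e he with h1 | h1 <;> rcases hP j e he' with h2 | h2
  · exact hp hij e (hpre i e h1).1 (hpre j e h2).1
  · exact hpost i j e h1 h2
  · exact hpost j i e h2 h1
  -- At the same end the entry edges differ, since the walks are edge-disjoint; at different ends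
  -- the extensions lie in disjoint components.
  · by_cases hωij : ω i = ω j
    · rw [hωij] at h1
      refine Set.disjoint_left.1 (hEd (ω j) _ _ fun h => ?_) h1 h2
      refine hp hij _ (hxyp i) ?_
      rw [(Prod.mk.inj h).1, (Prod.mk.inj h).2]
      exact hxyp j
    · obtain ⟨z, hz⟩ : ∃ z, z ∈ e := ⟨_, e.out_fst_mem⟩
      exact Set.disjoint_left.1
        (hZd _ (ω i).2 _ (ω j).2 fun h => hωij (Subtype.ext h))
        (hTZ _ (hET _ _ e h1 z hz)) (hTZ _ (hET _ _ e h2 z hz))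

end EdgeMenger

theorem mainTheorem4 {V : Type*} (G : SimpleGraph V) (hG : G.Connected)
    (S : Set V) (A : Set (EdgeMenger.EdgeEnd G))
    (F : Finset (Sym2 V)) (hFG : (F : Set (Sym2 V)) ⊆ G.edgeSet)
    (hF : EdgeMenger.Separates G S A (F : Set (Sym2 V)))
    (hmin : ∀ F' : Finset (Sym2 V), (F' : Set (Sym2 V)) ⊆ G.edgeSet →
      EdgeMenger.Separates G S A (F' : Set (Sym2 V)) → F.card ≤ F'.card) :
    ∃ P : Fin F.card → EdgeMenger.VertexEndPath G S A,
      Function.Injective P ∧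
        Pairwise fun i j => Disjoint (P i).edges (P j).edges := by
  have hX₀ := hF.endCut_reach F.finite_toSet
  have hk : ∀ X, EdgeMenger.EndCut G S A X → F.card ≤ (EdgeMenger.cut G X).ncard := by
    intro X hX
    rw [Set.ncard_eq_toFinset_card _ hX.finite]
    exact hmin _ (by simpa using EdgeMenger.cut_subset_edgeSet G X) (by simpa using hX.separates)
  obtain ⟨B, hBA, hB, hkB⟩ := EdgeMenger.exists_finite_ends hX₀ hk
  obtain ⟨P, hP⟩ := EdgeMenger.exists_disjoint_paths_of_finite hG hBA hB (hX₀.mono hBA) hkB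
  refine ⟨P, fun i j hij => ?_, hP⟩
  -- Two equal paths at different indices would be disjoint from themselves, hence edgeless, and an
  -- edgeless `S`–`A` path cannot be separated by `F`.
  by_contra hne
  have h := hP hne
  simp only [← hij, disjoint_self, Set.bot_eq_empty] at h
  exact hF (P i) (by rw [h]; exact Set.empty_disjoint _)
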